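/- Let $G$ be a finite connected undirected planar graph (parallel edges and loops are allowed) with a fixed planar embedding and positive real edge capacities. Let $G^*$ be its dual multigraph: its vertices are the faces of $G$, its faces correspond to the vertices of $G$, and the length of the dual edge $e^*$ is the capacity of $e$. Let $s\ne t$ be vertices of $G$, let $f_s$ be a face of $G$ incident with $s$ and $f_t$ a face incident with $t$, and let $\pi$ be a shortest path in $G^*$ from $f_s^*$ to $f_t^*$. An \emph{$st$-separating cycle} is a simple cycle $C$ of $G^*$ that separates $s$ from $t$, i.e. every walk from $s$ to $t$ in $G$ uses an edge $e$ with $e^*\in C$; it is \emph{shortest} if its length is minimum among all $st$-separating cycles. Orient $\pi$ from $f_s^*$ to $f_t^*$ and extend it at its ends by two dummy edges, one entering $f_s^*$ from $s$ through a corner of $f_s$ at $s$ and one leaving $f_t^*$ to $t$ through a corner of $f_t$ at $t$. Then every edge end at a vertex of $\pi$ that does not belong to $\pi$ lies to the left or to the right of $\pi$, according to the cyclic order of the embedding at that vertex. Fix an orientation of $C$. A \emph{crossing} between $C$ and $\pi$ is a subpath $v_1v_2\cdots v_k$ of $C$, $k\ge 3$ (followed along the orientation of $C$), such that the part from $v_2$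 to $v_{k-1}$ is a common subpath of $C$ and $\pi$ (possibly a single vertex, possibly traversed in opposite directions), and the ends at $v_2$ of the edge $v_1v_2$ and at $v_{k-1}$ of the edge $v_{k-1}v_k$ lie on different sides of $\pi$. The vertices $v_2,\dots,v_{k-1}$ are its \emph{internal vertices}. The crossing is \emph{down} if its first edge lies to the left of $\pi$ and \emph{up} if it lies to the right. The cycle $C$ is \emph{multiple-crossing} if it has more than one crossing with $\pi$. Let $C$ be a multiple-crossing shortest $st$-separating cycle, and let $L$ be the set of all internal vertices of all crossings between $C$ and $\pi$. Then: (A) There is exactly one pair of distinct vertices $a,b\in L$ that splits $C$ into two $ab$-paths $C(a,b)$ and $C'(a,b)$ such that 1. $C(a,b)$ contains no vertex of $L$ other than $a$ and $b$; 2. $C'(a,b)$ is a shortest $ab$-path in $G^*$; 3. all vertices of $L$ lie on $C'(a,b)$, and they appear along $C'(a,b)$ in the same order as along $\pi$, or in the reverse order; 4. all vertices of $L$ belong to the subpath $\pi(a,b)$ of $\pi$ between $a$ and $b$. Moreover, it is uniquely determined which of the two arcs is $C(a,b)$ and which is $C'(a,b)$. (B) There is exactly one pair of crossings between $C$ and $\pi$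 that are consecutive along $C$ and of the same type (both up or both down). -/

import Mathlib

/-- A connected planar graph (parallel edges and loops are allowed) together with a planar
embedding, given by its rotation system.  `D` is the set of darts (oriented edges), `rev` reverses
the orientation of a dart, and `rot` sends a dart to the next dart, counterclockwise, with the same
tail.  A connected rotation system is an embedding in the sphere exactly when it satisfies Euler's
formula. -/
structure PlaneGraph (D : Type*) where
  rev : Equiv.Perm D
  rot : Equiv.Perm D
  rev_rev : ∀ d, rev (rev d) = d
  rev_ne : ∀ d, rev d ≠ d
  connected : ∀ d e, Relation.ReflTransGen (fun x y => y = rev x ∨ y = rot x) d e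
  euler : Nat.card (Quotient (Equiv.Perm.SameCycle.setoid rot))
      + Nat.card (Quotient (Equiv.Perm.SameCycle.setoid (rot⁻¹ * rev)))
      = Nat.card (Quotient (Equiv.Perm.SameCycle.setoid rev)) + 2

namespace PlaneGraph

variable {D : Type*} (G : PlaneGraph D)

/-- `facePerm d` is the dart that follows `d` on the boundary of the face to the left of `d`,
the boundary being walked counterclockwise (with the face on the left). -/
def facePerm : Equiv.Perm D := G.rot⁻¹ * G.rev

/-- Vertices of `G`: the cycles of `rot` (a dart belongs to its tail). -/
abbrev Vertex : Type _ := Quotient (Equiv.Perm.SameCycle.setoid G.rot)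

/-- Edges of `G`, and also of the dual: the pairs `{d, rev d}`. -/
abbrev Edge : Type _ := Quotient (Equiv.Perm.SameCycle.setoid G.rev)

/-- Faces of `G`, that is, vertices of the dual graph. -/
abbrev Face : Type _ := Quotient (Equiv.Perm.SameCycle.setoid G.facePerm)

/-- The tail of a dart in `G`. -/
def vertex (d : D) : G.Vertex := Quotient.mk _ d

/-- The edge underlying a dart. -/
def edge (d : D) : G.Edge := Quotient.mk _ d

/-- The face to the left of a dart.  The dual dart of `d` crosses `d` from left to right: in the
dual graph it leads from `G.face d` to `G.face (G.rev d)`. -/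
def face (d : D) : G.Face := Quotient.mk _ d

/-! ### Paths in the dual graph -/

/-- The list of darts `p` is a walk in the dual graph from `f` to `g`. -/
def IsWalk : G.Face → List D → G.Face → Prop
  | f, [], g => f = g
  | f, d :: p, g => G.face d = f ∧ IsWalk (G.face (G.rev d)) p g

/-- The vertices (of the dual graph) of the walk `p` that starts in `f`, in order. -/
def support (f : G.Face) (p : List D) : List G.Face :=
  f :: p.map (fun d => G.face (G.rev d))

/-- Simple paths in the dual graph. -/
def IsPath (f : G.Face) (p : List D) (g : G.Face) : Prop :=
  G.IsWalk f p g ∧ (G.support f p).Nodup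

/-- The length of a walk, where `w e` is the length of the edge `e`. -/
def pathLength (w : G.Edge → ℝ) (p : List D) : ℝ :=
  (p.map (fun d => w (G.edge d))).sum

/-- `p` is a shortest path of the dual graph from `f` to `g`. -/
def IsShortestPath (w : G.Edge → ℝ) (f : G.Face) (p : List D) (g : G.Face) : Prop :=
  G.IsPath f p g ∧ ∀ q, G.IsPath f q g → G.pathLength w p ≤ G.pathLength w q

/-- The vertex `h` lies on the subpath between `f` and `g` of the path `p` (starting in `f₀`). -/
def OnSubpath (f₀ : G.Face) (p : List D) (f g h : G.Face) : Prop :=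
  ∃ i j k : ℕ, (G.support f₀ p)[i]? = some f ∧ (G.support f₀ p)[j]? = some h ∧
    (G.support f₀ p)[k]? = some g ∧ ((i ≤ j ∧ j ≤ k) ∨ (k ≤ j ∧ j ≤ i))

/-! ### Cycles in the dual graph -/

/-- The darts `c 0, c 1, …, c (n - 1)`, in this cyclic order, form a simple cycle of the dual graph.
The vertices of the cycle are `G.face (c i)`.  The last condition says that no edge is used in both
directions (it matters for `n = 2` only). -/
def IsCycle {n : ℕ} (c : ZMod n → D) : Prop :=
  (∀ i, G.face (G.rev (c i)) = G.face (c (i + 1))) ∧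
  Function.Injective (fun i => G.face (c i)) ∧
  ∀ i j, c i ≠ G.rev (c j)

/-- The cycle `c` separates `s` from `t`; vertices of `G` are the faces of the dual graph.
Every walk of `G` from `s` to `t` goes across an edge of the cycle. -/
def Separates {n : ℕ} (c : ZMod n → D) (s t : G.Vertex) : Prop :=
  ¬ Relation.ReflTransGen
    (fun u v => ∃ d, G.vertex d = u ∧ G.vertex (G.rev d) = v ∧ ∀ i, G.edge (c i) ≠ G.edge d) s t

/-- `st`-separating cycles. -/
def IsSepCycle (s t : G.Vertex) {n : ℕ} (c : ZMod n → D) : Prop :=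
  G.IsCycle c ∧ G.Separates c s t

/-- The length of a cycle. -/
def cycleLength (w : G.Edge → ℝ) {n : ℕ} [NeZero n] (c : ZMod n → D) : ℝ :=
  ∑ i, w (G.edge (c i))

/-- Shortest `st`-separating cycles. -/
def IsShortestSepCycle (w : G.Edge → ℝ) (s t : G.Vertex) {n : ℕ} [NeZero n]
    (c : ZMod n → D) : Prop :=
  G.IsSepCycle s t c ∧
  ∀ (m : ℕ) [NeZero m] (c' : ZMod m → D), G.IsSepCycle s t c' →
    G.cycleLength w c ≤ G.cycleLength w c'

/-- The arc of the cycle `c` that starts in the vertex `G.face (c i)` and has `k` edges. -/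
def arc {n : ℕ} (c : ZMod n → D) (i : ZMod n) (k : ℕ) : List D :=
  (List.range k).map (fun u : ℕ => c (i + (u : ZMod n)))

/-! ### Left and right of a path, crossings -/

/-- The counterclockwise cyclic order around the vertices of the dual graph.
`Sum.inl d` is the dual dart of `d`, leaving the dual vertex `G.face d`; `Sum.inr d` is the corner
that precedes it, that is, the corner of the face `G.face d` at the vertex `G.vertex d`. -/
def turn : D ⊕ D → D ⊕ D
  | Sum.inl d => Sum.inr (G.facePerm d)
  | Sum.inr d => Sum.inl d

/-- Turning counterclockwise from `x`, one meets `y` before `z`. -/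
def Between (x y z : D ⊕ D) : Prop :=
  ∃ k : ℕ, 1 ≤ k ∧ G.turn^[k] x = y ∧ ∀ j, 1 ≤ j → j ≤ k → G.turn^[j] x ≠ z

/-- The pairs (next edge, previous edge), one for each vertex of the dual path `p`, in order.
The path is extended at its ends by two dummy edges, which lie in the corners `ds` and `dt`. -/
def turns (ds dt : D) (p : List D) : List ((D ⊕ D) × (D ⊕ D)) :=
  (p.map Sum.inl ++ [Sum.inr dt]).zip (Sum.inr ds :: p.map (fun d => Sum.inl (G.rev d)))

/-- The dual dart of `d` starts in a vertex of the path `p` and lies to the left of the path. -/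
def LeftOf (ds dt : D) (p : List D) (d : D) : Prop :=
  ∃ q ∈ G.turns ds dt p, G.Between q.1 (Sum.inl d) q.2

/-- The dual dart of `d` starts in a vertex of the path `p` and lies to the right of the path. -/
def RightOf (ds dt : D) (p : List D) (d : D) : Prop :=
  ∃ q ∈ G.turns ds dt p, G.Between q.2 (Sum.inl d) q.1

/-- `X = (i, r)` is a crossing between the cycle `c` and the path `p`.  It is the subpath of `c` made
of the edges `c i, c (i + 1), …, c (i + r)`; its internal vertices are the starting points of
`c (i + 1), …, c (i + r)`.  The edges between internal vertices belong to `p`, and the first and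
the last edge lie on different sides of `p`. -/
def IsCrossing (ds dt : D) (p : List D) {n : ℕ} (c : ZMod n → D) (X : ZMod n × ℕ) : Prop :=
  1 ≤ X.2 ∧
  (∀ u : ℕ, 1 ≤ u → u < X.2 → ∃ d ∈ p, G.edge (c (X.1 + (u : ZMod n))) = G.edge d) ∧
  ((G.LeftOf ds dt p (G.rev (c X.1)) ∧ G.RightOf ds dt p (c (X.1 + (X.2 : ZMod n)))) ∨
   (G.RightOf ds dt p (G.rev (c X.1)) ∧ G.LeftOf ds dt p (c (X.1 + (X.2 : ZMod n)))))

/-- Down crossings (with respect to the orientation of `c`): the first edge is on the left. -/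
def IsDown (ds dt : D) (p : List D) {n : ℕ} (c : ZMod n → D) (X : ZMod n × ℕ) : Prop :=
  G.IsCrossing ds dt p c X ∧ G.LeftOf ds dt p (G.rev (c X.1))

/-- Up crossings (with respect to the orientation of `c`): the first edge is on the right. -/
def IsUp (ds dt : D) (p : List D) {n : ℕ} (c : ZMod n → D) (X : ZMod n × ℕ) : Prop :=
  G.IsCrossing ds dt p c X ∧ G.RightOf ds dt p (G.rev (c X.1))

/-- The cycle `c` is multiple-crossing: it has more than one crossing with the path `p`. -/
def IsMultipleCrossing (ds dt : D) (p : List D) {n : ℕ} (c : ZMod n → D) : Prop :=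
  ∃ X Y, X ≠ Y ∧ G.IsCrossing ds dt p c X ∧ G.IsCrossing ds dt p c Y

/-- The set of all internal vertices of all crossings between `c` and `p`. -/
def crossingVertices (ds dt : D) (p : List D) {n : ℕ} (c : ZMod n → D) : Set G.Face :=
  {f | ∃ X, G.IsCrossing ds dt p c X ∧
    ∃ u : ℕ, 1 ≤ u ∧ u ≤ X.2 ∧ G.face (c (X.1 + (u : ZMod n))) = f}

/-- `X` and `Y` are different crossings, and `Y` is the first crossing after `X` along `c`. -/
def Consecutive (ds dt : D) (p : List D) {n : ℕ} (c : ZMod n → D) (X Y : ZMod n × ℕ) : Prop :=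
  G.IsCrossing ds dt p c X ∧ G.IsCrossing ds dt p c Y ∧ X ≠ Y ∧
  ∀ u r : ℕ, 0 < u → u < (Y.1 - X.1).val → ¬ G.IsCrossing ds dt p c (X.1 + (u : ZMod n), r)

/-- The vertices `a = G.face (c x)` and `b = G.face (c y)` split the cycle `c` in the required way.
The arc `C'(a, b)` of `c` leads from `a` to `b` in the direction of `c`, and `C(a, b)` is the other
arc, leading from `b` to `a` in the direction of `c`; swapping `x` and `y` swaps the two arcs. -/
structure IsDecomposition (w : G.Edge → ℝ) (ds dt : D) (p : List D) {n : ℕ} (c : ZMod n → D)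
    (x y : ZMod n) : Prop where
  ne : x ≠ y
  left_mem : G.face (c x) ∈ G.crossingVertices ds dt p c
  right_mem : G.face (c y) ∈ G.crossingVertices ds dt p c
  /-- the interior of `C(a, b)` contains no internal vertex of a crossing -/
  no_crossing : ∀ u : ℕ, 0 < u → u < (x - y).val →
    G.face (c (y + (u : ZMod n))) ∉ G.crossingVertices ds dt p c
  /-- `C'(a, b)` is a shortest `ab`-path -/
  shortest : G.IsShortestPath w (G.face (c x)) (arc c x (y - x).val) (G.face (c y))
  /-- all internal vertices of crossings are on `C'(a, b)` -/
  mem_arc : ∀ f ∈ G.crossingVertices ds dt p c,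
    f ∈ G.support (G.face (c x)) (arc c x (y - x).val)
  /-- they appear on `C'(a, b)` in the same order as on `p`, or in the reverse order -/
  order :
    (∀ f ∈ G.crossingVertices ds dt p c, ∀ g ∈ G.crossingVertices ds dt p c, ∀ i j k l : ℕ,
      (G.support (G.face (c x)) (arc c x (y - x).val))[i]? = some f →
      (G.support (G.face (c x)) (arc c x (y - x).val))[j]? = some g →
      (G.support (G.face ds) p)[k]? = some f → (G.support (G.face ds) p)[l]? = some g →
      (i < j ↔ k < l)) ∨
    (∀ f ∈ G.crossingVertices ds dt p c, ∀ g ∈ G.crossingVertices ds dt p c, ∀ i j k l : ℕ,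
      (G.support (G.face (c x)) (arc c x (y - x).val))[i]? = some f →
      (G.support (G.face (c x)) (arc c x (y - x).val))[j]? = some g →
      (G.support (G.face ds) p)[k]? = some f → (G.support (G.face ds) p)[l]? = some g →
      (i < j ↔ l < k))
  /-- all internal vertices of crossings are on the subpath of `p` between `a` and `b` -/
  mem_subpath : ∀ f ∈ G.crossingVertices ds dt p c,
    G.OnSubpath (G.face ds) p (G.face (c x)) (G.face (c y)) f

end PlaneGraph

set_option linter.unusedSectionVars false

/-! ### Potentials on the sphere: closed functions of darts are coboundaries. -/

namespace PlaneGraph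

variable {D : Type*} (G : PlaneGraph D)

/-! Everything rests on one integer, the intersection number `lam` of a dual walk with a curve
pushed off the left side of `p`. Planarity enters through Euler's formula alone: a dimension count
shows that antisymmetric functions of darts with zero sum around every face are coboundaries of
vertex potentials (`exists_potential`). The sum of a coboundary over the darts left of `p`
telescopes to the potential difference between `s` and `t` (`sum_leftInd_mul_coboundary`). Hence a
closed walk with nonzero number separates `s` from `t`, and a simple separating cycle has number 1
or -1. Cutting closed walks into simple cycles gives `abs_lamSum_mul_le`: the length is at least the
absolute value of the number times ℓ, the length of `c`.

Let two vertices of `p` split `c` into arcs A and B. Close each arc by the segment P of `p`, which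
contributes 0. Then |λ(A)|ℓ ≤ |A| + |P| and |λ(B)|ℓ ≤ |B| + |P|, and P is no longer than A or B, so
|λ(A)| + |λ(B)| ≤ 2. As λ(A) + λ(B) = ±1, one of the two numbers is 0. If λ(A) = 0, then ℓ ≤ |B| +
|P|, that is |A| ≤ |P|, so A is a shortest walk. This is `arc_dichotomy`; applied to nested arcs, it
shows that of two disjoint arcs at most one has nonzero number (`not_both`).

From a crossing to the next one, `c` collects ±1 if the types agree and 0 otherwise
(`arcSum_of_consecutive`, `sameType_iff`). The total ±1 therefore produces a consecutive pair of
equal type, and `not_both` makes it unique: this is (B).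

For (A), the vertices `a`, `b` are the ends of the gap between these two crossings. The
complementary arc has number 0, so it is shortest, and distances force it to visit vertices of `p`
monotonically. Any other decomposition also comes from a gap between internal vertices. If its
number is nonzero, it is the same gap. If it is 0, both of its arcs are shortest, each is half of
`c`, and the gap must be the arc complementary to the first one. The two crossings would then be
consecutive in both directions, contradicting (B). -/

theorem vertex_rot (d : D) : G.vertex (G.rot d) = G.vertex d :=
  Quotient.sound (s := Equiv.Perm.SameCycle.setoid G.rot)
    (Equiv.Perm.sameCycle_apply_left.2 (Equiv.Perm.SameCycle.refl _ _))

theorem vertex_facePerm (d : D) : G.vertex (G.facePerm d) = G.vertex (G.rev d) := by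
  rw [← G.vertex_rot (G.facePerm d)]
  simp [facePerm]

theorem face_facePerm (d : D) : G.face (G.facePerm d) = G.face d :=
  Quotient.sound (s := Equiv.Perm.SameCycle.setoid G.facePerm)
    (Equiv.Perm.sameCycle_apply_left.2 (Equiv.Perm.SameCycle.refl _ _))

theorem edge_rev (d : D) : G.edge (G.rev d) = G.edge d :=
  Quotient.sound (s := Equiv.Perm.SameCycle.setoid G.rev)
    (Equiv.Perm.sameCycle_apply_left.2 (Equiv.Perm.SameCycle.refl _ _))

theorem edge_eq_iff (d e : D) : G.edge d = G.edge e ↔ d = e ∨ d = G.rev e := by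
  constructor
  · intro h
    obtain ⟨i, hi⟩ : G.rev.SameCycle e d := (Quotient.exact h.symm :)
    have hsq : G.rev ^ (2 : ℤ) = 1 := by
      ext x
      rw [zpow_two]
      simp [G.rev_rev]
    rcases Int.even_or_odd' i with ⟨k, rfl | rfl⟩
    · left
      simpa [zpow_mul, hsq] using hi.symm
    · right
      simpa [zpow_add, zpow_mul, hsq] using hi.symm
  · rintro (rfl | rfl)
    · rfl
    · exact G.edge_rev e

/-- A function of the vertices that agrees at the two ends of every edge is constant. -/
theorem vertex_const {α : Type*} (h : G.Vertex → α)
    (hh : ∀ d, h (G.vertex (G.rev d)) = h (G.vertex d)) (u v : G.Vertex) : h u = h v := by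
  induction u using Quotient.inductionOn with | _ d =>
  induction v using Quotient.inductionOn with | _ e =>
  change h (G.vertex d) = h (G.vertex e)
  induction G.connected d e with
  | refl => rfl
  | tail _ hxy ih =>
    rw [ih]
    rcases hxy with rfl | rfl
    · exact (hh _).symm
    · rw [vertex_rot]

/-- A function of the faces that agrees on the two sides of every edge is constant. -/
theorem face_const {α : Type*} (k : G.Face → α)
    (hk : ∀ d, k (G.face (G.rev d)) = k (G.face d)) (f g : G.Face) : k f = k g := by
  induction f using Quotient.inductionOn with | _ d =>
  induction g using Quotient.inductionOn with | _ e =>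
  change k (G.face d) = k (G.face e)
  induction G.connected d e with
  | refl => rfl
  | @tail x y _ hxy ih =>
    rw [ih]
    rcases hxy with rfl | rfl
    · exact (hk _).symm
    · have : G.facePerm (G.rev (G.rot x)) = x := by simp [facePerm, G.rev_rev]
      rw [← this, face_facePerm, this, hk]

/-- Functions of edges are compared through the chosen dart `e.out`; antisymmetry carries the
identity over to the other dart. -/
theorem eq_of_antisymm {z z' : D → ℝ} (hz : ∀ d, z (G.rev d) = -z d)
    (hz' : ∀ d, z' (G.rev d) = -z' d) (h : ∀ e : G.Edge, z e.out = z' e.out) (d : D) :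
    z d = z' d := by
  have he : G.edge d = G.edge (G.edge d).out := (Quotient.out_eq (G.edge d)).symm
  rcases (G.edge_eq_iff _ _).1 he with h1 | h1
  · rw [h1]; exact h _
  · rw [h1, hz, hz', h]

section Fintype

variable [Fintype D]

/-- Coboundaries are orthogonal to the functions of the faces. -/
theorem sum_coboundary_mul_face (h : G.Vertex → ℝ) (k : G.Face → ℝ) :
    ∑ d, (h (G.vertex (G.rev d)) - h (G.vertex d)) * k (G.face d) = 0 := by
  simp only [sub_mul, Finset.sum_sub_distrib, sub_eq_zero]
  rw [← Equiv.sum_comp G.facePerm (fun d => h (G.vertex d) * k (G.face d))]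
  simp only [vertex_facePerm, face_facePerm]

/-- A closed antisymmetric function is orthogonal to the coboundaries of the dual graph. -/
theorem sum_mul_dual_coboundary (z : D → ℝ) (hz : ∀ d, z (G.rev d) = -z d)
    (hclosed : ∀ k : G.Face → ℝ, ∑ d, z d * k (G.face d) = 0) (k : G.Face → ℝ) :
    ∑ d, z d * (k (G.face (G.rev d)) - k (G.face d)) = 0 := by
  have h1 := hclosed k
  have h2 : ∑ d, z d * k (G.face (G.rev d)) = -∑ d, z d * k (G.face d) := by
    rw [← Equiv.sum_comp G.rev (fun d => z d * k (G.face d)), ← Finset.sum_neg_distrib]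
    refine Finset.sum_congr rfl fun d _ => ?_
    rw [hz]; ring
  simp only [mul_sub, Finset.sum_sub_distrib, h1, h2]
  simp

/-- Dual coboundaries are orthogonal to closed antisymmetric functions, hence both to `z` and to the
coboundary of `h`. The coboundary of `k` is the difference of these two, so it is orthogonal to
itself. -/
theorem dual_coboundary_eq_zero (h : G.Vertex → ℝ) (k : G.Face → ℝ) (z : D → ℝ)
    (hz : ∀ d, z (G.rev d) = -z d)
    (hclosed : ∀ k : G.Face → ℝ, ∑ d, z d * k (G.face d) = 0)
    (e : ∀ d, z d = (h (G.vertex (G.rev d)) - h (G.vertex d))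
      + (k (G.face (G.rev d)) - k (G.face d))) (d : D) :
    k (G.face (G.rev d)) - k (G.face d) = 0 := by
  have h1 := G.sum_mul_dual_coboundary z hz hclosed k
  have h2 := G.sum_mul_dual_coboundary (fun d => h (G.vertex (G.rev d)) - h (G.vertex d))
    (fun d => by simp [G.rev_rev]) (G.sum_coboundary_mul_face h) k
  have h3 : ∑ d, (k (G.face (G.rev d)) - k (G.face d)) ^ 2 = 0 := by
    rw [← sub_eq_zero.2 (h1.trans h2.symm), ← Finset.sum_sub_distrib]
    refine Finset.sum_congr rfl fun d _ => ?_
    rw [e]; ring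
  exact pow_eq_zero_iff two_ne_zero |>.1
    ((Finset.sum_eq_zero_iff_of_nonneg (fun _ _ => sq_nonneg _)).1 h3 d (Finset.mem_univ d))

/-- The sum of the coboundary of a function of the vertices and of the coboundary, in the dual
graph, of a function of the faces. -/
noncomputable def hodgeMap :
    ((G.Vertex → ℝ) × (G.Face → ℝ)) →ₗ[ℝ] (G.Edge → ℝ) where
  toFun x e := (x.1 (G.vertex (G.rev e.out)) - x.1 (G.vertex e.out))
      + (x.2 (G.face (G.rev e.out)) - x.2 (G.face e.out))
  map_add' x y := by ext e; simp; ring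
  map_smul' a x := by ext e; simp; ring

/-- The kernel consists of pairs of constants, so its dimension is at most 2. Since V + F = E + 2,
the range has dimension at least E. This is the only use of Euler's formula. -/
theorem hodgeMap_surjective [Nonempty D] : Function.Surjective G.hodgeMap := by
  classical
  have : Fintype G.Vertex := Fintype.ofFinite _
  have : Fintype G.Face := Fintype.ofFinite _
  have : Fintype G.Edge := Fintype.ofFinite _
  obtain ⟨d₀⟩ := ‹Nonempty D›
  let κ : (ℝ × ℝ) →ₗ[ℝ] ((G.Vertex → ℝ) × (G.Face → ℝ)) :=
    { toFun := fun x => (fun _ => x.1, fun _ => x.2)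
      map_add' := fun _ _ => rfl
      map_smul' := fun _ _ => rfl }
  have hker : LinearMap.ker G.hodgeMap ≤ LinearMap.range κ := by
    rintro ⟨h, k⟩ hx
    have hx' : ∀ d, (0 : ℝ) = (h (G.vertex (G.rev d)) - h (G.vertex d))
        + (k (G.face (G.rev d)) - k (G.face d)) := by
      refine G.eq_of_antisymm (z := fun _ => 0) (by simp) (fun d => ?_) (fun e => ?_)
      · simp only [G.rev_rev]; ring
      · exact (congrFun (LinearMap.mem_ker.1 hx) e).symm
    have hk := G.dual_coboundary_eq_zero h k (fun _ => 0) (by simp) (by simp) hx'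
    have hh : ∀ d, h (G.vertex (G.rev d)) = h (G.vertex d) := fun d => by
      have := hx' d; have := hk d; linarith
    refine ⟨(h (G.vertex d₀), k (G.face d₀)), ?_⟩
    refine Prod.ext (funext fun v => ?_) (funext fun f => ?_)
    · exact G.vertex_const h hh _ _
    · exact G.face_const k (fun d => by have := hk d; linarith) _ _
  have h1 : Module.finrank ℝ (LinearMap.ker G.hodgeMap) ≤ 2 := by
    refine (Submodule.finrank_mono hker).trans ((LinearMap.finrank_range_le κ).trans ?_)
    simp
  have h2 := LinearMap.finrank_range_add_finrank_ker G.hodgeMap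
  have h3 : Module.finrank ℝ ((G.Vertex → ℝ) × (G.Face → ℝ))
      = Nat.card G.Vertex + Nat.card G.Face := by simp
  have h4 : Nat.card G.Vertex + Nat.card G.Face = Nat.card G.Edge + 2 := G.euler
  rw [← LinearMap.range_eq_top]
  apply Submodule.eq_top_of_finrank_eq
  apply le_antisymm (Submodule.finrank_le _)
  have h5 : Module.finrank ℝ (G.Edge → ℝ) = Nat.card G.Edge := by simp
  omega

/-- In the sphere, closed antisymmetric functions are coboundaries. -/
theorem exists_potential (z : D → ℝ) (hz : ∀ d, z (G.rev d) = -z d)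
    (hclosed : ∀ k : G.Face → ℝ, ∑ d, z d * k (G.face d) = 0) :
    ∃ h : G.Vertex → ℝ, ∀ d, z d = h (G.vertex (G.rev d)) - h (G.vertex d) := by
  rcases isEmpty_or_nonempty D with _ | _
  · exact ⟨fun _ => 0, fun d => isEmptyElim d⟩
  obtain ⟨⟨h, k⟩, hx⟩ := G.hodgeMap_surjective (fun e => z e.out)
  have e : ∀ d, z d = (h (G.vertex (G.rev d)) - h (G.vertex d))
      + (k (G.face (G.rev d)) - k (G.face d)) := by
    refine G.eq_of_antisymm hz (fun d => ?_) (fun e => (congrFun hx e).symm)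
    simp only [G.rev_rev]; ring
  refine ⟨h, fun d => ?_⟩
  rw [e, G.dual_coboundary_eq_zero h k z hz hclosed e, add_zero]

end Fintype

end PlaneGraph

/-! ### The two sides of a dual path, read off from the rotation system. -/

namespace PlaneGraph

variable {D : Type*} (G : PlaneGraph D)

/-! ### Cyclic order -/

/-- The vertex of the dual graph at which an edge end or a corner lies. -/
def base : D ⊕ D → G.Face
  | Sum.inl d => G.face d
  | Sum.inr d => G.face d

theorem turn_injective : Function.Injective G.turn := by
  rintro (d | d) (e | e) h <;> simp_all [turn]

theorem base_turn (x : D ⊕ D) : G.base (G.turn x) = G.base x := by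
  rcases x with d | d
  · exact G.face_facePerm d
  · rfl

theorem base_iterate_turn (k : ℕ) (x : D ⊕ D) : G.base (G.turn^[k] x) = G.base x := by
  induction k with
  | zero => rfl
  | succ k ih => rw [Function.iterate_succ_apply', base_turn, ih]

theorem iterate_turn_inl (k : ℕ) (d : D) :
    G.turn^[2 * k] (Sum.inl d) = Sum.inl ((G.facePerm ^ k) d) := by
  induction k with
  | zero => rfl
  | succ k ih =>
    rw [show 2 * (k + 1) = 2 + 2 * k by ring, Function.iterate_add_apply, ih, pow_succ',
      Equiv.Perm.mul_apply]
    rfl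

theorem Between.base_eq {x y z : D ⊕ D} (h : G.Between x y z) : G.base y = G.base x := by
  obtain ⟨k, -, rfl, -⟩ := h
  exact G.base_iterate_turn k x

section Finite

variable [Finite D]

theorem exists_iterate_turn_self (x : D ⊕ D) : ∃ k, 1 ≤ k ∧ G.turn^[k] x = x := by
  have := G.turn_injective.mem_periodicPts x
  obtain ⟨k, hk, h⟩ := this
  exact ⟨k, hk, h⟩

theorem exists_iterate_turn {x y : D ⊕ D} (h : G.base x = G.base y) :
    ∃ k, 1 ≤ k ∧ G.turn^[k] x = y := by
  have key : ∀ d e : D, G.face d = G.face e → ∃ k, G.turn^[k] (Sum.inl d) = Sum.inl e := by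
    intro d e h
    obtain ⟨k, -, hk⟩ := (show G.facePerm.SameCycle d e from Quotient.exact h).exists_pow_eq'
    exact ⟨2 * k, by rw [iterate_turn_inl, hk]⟩
  have toInl : ∀ x : D ⊕ D, ∃ d k, G.turn^[k] x = Sum.inl d := by
    rintro (d | d)
    · exact ⟨d, 0, rfl⟩
    · exact ⟨d, 1, rfl⟩
  have back : ∀ x y : D ⊕ D, ∀ k, G.turn^[k] x = y → ∃ l, G.turn^[l] y = x := by
    rintro x y k rfl
    obtain ⟨m, hm, h⟩ := G.exists_iterate_turn_self x
    have hp : Function.IsPeriodicPt G.turn (m * (k + 1)) x :=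
      Function.IsPeriodicPt.mul_const (show Function.IsPeriodicPt G.turn m x from h) (k + 1)
    -- A multiple of the period `m` that is at least `k`, so that going on from `y` closes up at
    -- `x`.
    refine ⟨m * (k + 1) - k, ?_⟩
    have : k ≤ m * (k + 1) := by nlinarith
    rw [← Function.iterate_add_apply, Nat.sub_add_cancel this]
    exact hp
  obtain ⟨d, k, hk⟩ := toInl x
  obtain ⟨e, l, hl⟩ := toInl y
  obtain ⟨l', hl'⟩ := back _ _ _ hl
  obtain ⟨m, hm⟩ := key d e (by
    have h1 := G.base_iterate_turn k x
    have h2 := G.base_iterate_turn l y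
    rw [hk] at h1; rw [hl] at h2
    exact h1.trans (h.trans h2.symm))
  obtain ⟨r, hr, hr'⟩ := G.exists_iterate_turn_self x
  refine ⟨l' + (m + (k + r)), by omega, ?_⟩
  rw [Function.iterate_add_apply, Function.iterate_add_apply, Function.iterate_add_apply,
    hr', hk, hm, hl']

/-- Of three different ends at the same vertex, the second lies either between the first and the
third or between the third and the first. -/
theorem between_or_between {x y z : D ⊕ D} (hy : G.base x = G.base y) (hxy : y ≠ x)
    (hyz : y ≠ z) : G.Between x y z ∨ G.Between z y x := by
  classical
  -- Take the first visit to `y`: either `z` has not been met by then, or the remaining turn from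
  -- `z` to `y` avoids `x`.
  have hex := G.exists_iterate_turn hy
  let k := Nat.find hex
  obtain ⟨hk1, hk⟩ : 1 ≤ k ∧ G.turn^[k] x = y := Nat.find_spec hex
  have hmin : ∀ m, 1 ≤ m → m < k → G.turn^[m] x ≠ y := fun m h1 h2 h3 =>
    Nat.find_min hex h2 ⟨h1, h3⟩
  by_cases hz : ∀ j, 1 ≤ j → j ≤ k → G.turn^[j] x ≠ z
  · exact Or.inl ⟨k, hk1, hk, hz⟩
  · push Not at hz
    obtain ⟨j, hj1, hjk, rfl⟩ := hz
    have hjk' : j < k := lt_of_le_of_ne hjk (by rintro rfl; exact hyz hk.symm)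
    refine Or.inr ⟨k - j, by omega, ?_, fun i hi1 hi2 h => ?_⟩
    · rw [← Function.iterate_add_apply, Nat.sub_add_cancel hjk, hk]
    · rw [← Function.iterate_add_apply] at h
      have h4 : G.turn^[k - (i + j)] x = y := by
        conv_lhs => rw [← h]
        rw [← Function.iterate_add_apply, Nat.sub_add_cancel (by omega), hk]
      rcases Nat.eq_zero_or_pos (k - (i + j)) with h0 | h0
      · rw [h0] at h4; exact hxy h4.symm
      · exact hmin _ h0 (by omega) h4

end Finite

theorem not_between_and_between {x y z : D ⊕ D} (hxz : x ≠ z) (h1 : G.Between x y z)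
    (h2 : G.Between z y x) : False := by
  obtain ⟨k, hk1, rfl, hk⟩ := h1
  obtain ⟨l, hl1, hl, hl'⟩ := h2
  rcases le_total k l with h | h
  · have : G.turn^[k] (G.turn^[l - k] z) = G.turn^[k] x := by
      rw [← Function.iterate_add_apply, Nat.add_sub_cancel' h, hl]
    have := G.turn_injective.iterate k this
    rcases Nat.eq_zero_or_pos (l - k) with h0 | h0
    · rw [h0] at this; exact hxz this.symm
    · exact hl' _ h0 (by omega) this
  · have : G.turn^[l] (G.turn^[k - l] x) = G.turn^[l] z := by
      rw [← Function.iterate_add_apply, Nat.add_sub_cancel' h, hl]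
    have := G.turn_injective.iterate l this
    rcases Nat.eq_zero_or_pos (k - l) with h0 | h0
    · rw [h0] at this; exact hxz this
    · exact hk _ h0 (by omega) this

theorem not_between_right {x z : D ⊕ D} : ¬ G.Between x z z :=
  fun ⟨k, hk1, hk, h⟩ => h k hk1 le_rfl hk

theorem not_between_left [Finite D] {x z : D ⊕ D} (hb : G.base x = G.base z) (hxz : x ≠ z) :
    ¬ G.Between x x z := by
  rintro ⟨k, hk1, hk, h⟩
  obtain ⟨i, hi1, hi⟩ := G.exists_iterate_turn hb
  have hp : Function.IsPeriodicPt G.turn k x := hk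
  have h3 := hp.iterate_mod_apply i
  rw [hi] at h3
  rcases Nat.eq_zero_or_pos (i % k) with h0 | h0
  · rw [h0] at h3; exact hxz h3
  · exact h _ h0 (Nat.mod_lt _ hk1).le h3

/-! ### Sums of coboundaries -/

/-- The value of a function of the vertices of `G` at the corner that precedes an edge end. -/
def cornerValue (h : G.Vertex → ℝ) : D ⊕ D → ℝ
  | Sum.inl d => h (G.vertex d)
  | Sum.inr d => h (G.vertex d)

theorem cornerValue_turn (h : G.Vertex → ℝ) (x : D ⊕ D) :
    G.cornerValue h (G.turn x) - G.cornerValue h x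
      = Sum.elim (fun d => h (G.vertex (G.rev d)) - h (G.vertex d)) (fun _ => 0) x := by
  rcases x with d | d
  · simp [turn, cornerValue, vertex_facePerm]
  · simp [turn, cornerValue]

-- Turning past an edge end moves from one corner to the next, and the change of the corner value is
-- the coboundary at that dart. The sum over the ends strictly between `x` and `z` telescopes.
open Classical in
theorem sum_between [Fintype D] (h : G.Vertex → ℝ) {x z : D ⊕ D} (hb : G.base x = G.base z) :
    ∑ d, (if G.Between x (Sum.inl d) z then h (G.vertex (G.rev d)) - h (G.vertex d) else 0)
      = G.cornerValue h z - G.cornerValue h (G.turn x) := by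
  have hex := G.exists_iterate_turn hb
  let k := Nat.find hex
  obtain ⟨hk1, hk⟩ : 1 ≤ k ∧ G.turn^[k] x = z := Nat.find_spec hex
  have hmin : ∀ m, 1 ≤ m → m < k → G.turn^[m] x ≠ z := fun m h1 h2 h3 =>
    Nat.find_min hex h2 ⟨h1, h3⟩
  set φ : D ⊕ D → ℝ :=
    Sum.elim (fun d => h (G.vertex (G.rev d)) - h (G.vertex d)) (fun _ => 0) with hφ
  have himage : (Finset.univ.filter fun y => G.Between x y z)
      = (Finset.Ico 1 k).image fun j => G.turn^[j] x := by
    ext y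
    simp only [Finset.mem_filter, Finset.mem_univ, true_and, Finset.mem_image, Finset.mem_Ico]
    constructor
    · rintro ⟨j, hj1, rfl, hj⟩
      refine ⟨j, ⟨hj1, ?_⟩, rfl⟩
      by_contra hjk
      exact hj k hk1 (not_lt.1 hjk) hk
    · rintro ⟨j, ⟨hj1, hjk⟩, rfl⟩
      exact ⟨j, hj1, rfl, fun i hi1 hi2 => hmin i hi1 (by omega)⟩
  have hinj : Set.InjOn (fun j => G.turn^[j] x) (Finset.Ico 1 k : Finset ℕ) := by
    have : ∀ i j, 1 ≤ i → i < j → j < k → G.turn^[i] x ≠ G.turn^[j] x := by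
      intro i j hi hij hjk he
      have h1 : G.turn^[k - j + i] x = z := by
        rw [Function.iterate_add_apply, he, ← Function.iterate_add_apply,
          Nat.sub_add_cancel hjk.le, hk]
      exact hmin _ (by omega) (by omega) h1
    intro i hi j hj he
    simp only [Finset.coe_Ico, Set.mem_Ico] at hi hj
    rcases lt_trichotomy i j with hij | hij | hij
    · exact absurd he (this i j hi.1 hij hj.2)
    · exact hij
    · exact absurd he.symm (this j i hj.1 hij hi.2)
  have h1 : ∑ d, (if G.Between x (Sum.inl d) z then h (G.vertex (G.rev d)) - h (G.vertex d) else 0)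
      = ∑ y, if G.Between x y z then φ y else 0 := by
    rw [Fintype.sum_sum_type]
    simp [hφ]
  rw [h1, ← Finset.sum_filter, himage, Finset.sum_image hinj]
  simp only [hφ, ← cornerValue_turn, ← Function.iterate_succ_apply' G.turn]
  rw [Finset.sum_Ico_eq_sum_range]
  have h2 := Finset.sum_range_sub (fun j => G.cornerValue h (G.turn^[1 + j] x)) (k - 1)
  simp only [Nat.add_sub_cancel' hk1, hk] at h2
  simpa [← add_assoc, Function.iterate_succ_apply'] using h2

/-! ### The sides of a path -/

theorem map_base_next (ds dt : D) (p : List D) (hp : G.IsWalk (G.face ds) p (G.face dt)) :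
    (p.map Sum.inl ++ [Sum.inr dt]).map G.base = G.support (G.face ds) p := by
  generalize G.face ds = f at hp
  induction p generalizing f with
  | nil => simpa [support, base] using hp.symm
  | cons d p ih =>
    have := ih _ hp.2
    simp only [support, List.map_cons, List.cons_append] at this ⊢
    rw [this, base, hp.1]

theorem map_base_prev (ds : D) (p : List D) :
    (Sum.inr ds :: p.map (fun d => Sum.inl (G.rev d))).map G.base
      = G.support (G.face ds) p := by
  simp [support, base, Function.comp_def]

variable {G} {ds dt : D} {p : List D}

theorem base_of_mem_turns (hp : G.IsWalk (G.face ds) p (G.face dt)) {q : (D ⊕ D) × (D ⊕ D)}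
    (hq : q ∈ G.turns ds dt p) : G.base q.1 = G.base q.2 := by
  have h1 : (G.turns ds dt p).map (fun q => G.base q.1) = G.support (G.face ds) p := by
    rw [← G.map_base_next ds dt p hp, turns, ← Function.comp_def, ← List.map_map,
      List.map_fst_zip (by simp)]
  have h2 : (G.turns ds dt p).map (fun q => G.base q.2) = G.support (G.face ds) p := by
    rw [← G.map_base_prev ds p, turns, ← Function.comp_def, ← List.map_map,
      List.map_snd_zip (by simp)]
  exact List.map_inj_left.1 (h1.trans h2.symm) q hq

theorem map_base_turns (hp : G.IsWalk (G.face ds) p (G.face dt)) :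
    (G.turns ds dt p).map (fun q => G.base q.1) = G.support (G.face ds) p := by
  rw [← G.map_base_next ds dt p hp, turns, ← Function.comp_def, ← List.map_map,
    List.map_fst_zip (by simp)]

theorem eq_of_mem_turns (hp : G.IsPath (G.face ds) p (G.face dt)) {q q' : (D ⊕ D) × (D ⊕ D)}
    (hq : q ∈ G.turns ds dt p) (hq' : q' ∈ G.turns ds dt p) (h : G.base q.1 = G.base q'.1) :
    q = q' :=
  List.inj_on_of_nodup_map (by rw [map_base_turns hp.1]; exact hp.2) hq hq' h

/-- Equal entries would mean that the path turns back along the edge it came by, repeating a vertex.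
For the empty path both entries are dummy edges, and they differ because `ds ≠ dt`. -/
theorem ne_of_mem_turns (hp : G.IsPath (G.face ds) p (G.face dt)) (hne : ds ≠ dt)
    {q : (D ⊕ D) × (D ⊕ D)} (hq : q ∈ G.turns ds dt p) : q.1 ≠ q.2 := by
  have key : ∀ (f : G.Face) (x : D ⊕ D), G.IsPath f p (G.face dt) → x ≠ Sum.inr dt →
      (∀ d, x = Sum.inl d → ∀ e ∈ p, e ≠ d) →
      q ∈ (p.map Sum.inl ++ [Sum.inr dt]).zip (x :: p.map (fun d => Sum.inl (G.rev d))) →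
      q.1 ≠ q.2 := by
    clear hq hp
    induction p with
    | nil =>
      rintro f x - hx - hq
      simp only [List.map_nil, List.nil_append, List.zip_cons_cons, List.zip_nil_right,
        List.mem_singleton] at hq
      rw [hq]; exact hx.symm
    | cons d p ih =>
      rintro f x ⟨hw, hn⟩ hx hx' hq
      simp only [List.map_cons, List.cons_append, List.zip_cons_cons, List.mem_cons] at hq
      rcases hq with rfl | hq
      · intro he
        exact hx' d he.symm d List.mem_cons_self rfl
      · refine ih (G.face (G.rev d)) _ ⟨hw.2, ?_⟩ (by simp) ?_ hq
        · simp only [support, List.map_cons, List.nodup_cons] at hn ⊢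
          exact hn.2
        · rintro d' hd' e he rfl
          obtain rfl := Sum.inl.inj hd'
          simp only [support, List.map_cons, List.nodup_cons, List.mem_cons, not_or] at hn
          refine hn.1.2 ?_
          rw [List.mem_map]
          exact ⟨_, he, by rw [G.rev_rev, hw.1]⟩
  exact key _ _ hp (by simpa using hne) (by simp) hq

/-- The dual dart of `d` lies on the path, in one of the two directions. -/
def OnPath (G : PlaneGraph D) (p : List D) (d : D) : Prop := ∃ e ∈ p, G.edge d = G.edge e

theorem onPath_iff {d : D} : G.OnPath p d ↔ d ∈ p ∨ G.rev d ∈ p := by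
  constructor
  · rintro ⟨e, he, h⟩
    rcases (G.edge_eq_iff _ _).1 h with rfl | rfl
    · exact Or.inl he
    · exact Or.inr (by rwa [G.rev_rev])
  · rintro (h | h)
    · exact ⟨_, h, rfl⟩
    · exact ⟨_, h, (G.edge_rev d).symm⟩

theorem onPath_rev {d : D} : G.OnPath p (G.rev d) ↔ G.OnPath p d := by
  simp only [OnPath, edge_rev]

theorem mem_turns_next {d : D} (hd : d ∈ p) : ∃ q ∈ G.turns ds dt p, q.1 = Sum.inl d := by
  have : Sum.inl d ∈ (G.turns ds dt p).map Prod.fst := by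
    rw [turns, List.map_fst_zip (by simp)]
    simp [hd]
  simpa using this

theorem mem_turns_prev {d : D} (hd : G.rev d ∈ p) :
    ∃ q ∈ G.turns ds dt p, q.2 = Sum.inl d := by
  have : Sum.inl d ∈ (G.turns ds dt p).map Prod.snd := by
    rw [turns, List.map_snd_zip (by simp)]
    simp only [List.mem_cons, List.mem_map]
    exact Or.inr ⟨_, hd, by rw [G.rev_rev]⟩
  simpa using this

theorem onPath_of_mem_turns {d : D} {q : (D ⊕ D) × (D ⊕ D)} (hq : q ∈ G.turns ds dt p)
    (h : Sum.inl d = q.1 ∨ Sum.inl d = q.2) : G.OnPath p d := by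
  rw [onPath_iff]
  rcases h with h | h
  · left
    have : q.1 ∈ p.map Sum.inl ++ [Sum.inr dt] := (List.of_mem_zip hq).1
    simpa [← h] using this
  · right
    have : q.2 ∈ Sum.inr ds :: p.map (fun d => Sum.inl (G.rev d)) := (List.of_mem_zip hq).2
    rw [← h] at this
    simp only [List.mem_cons, List.mem_map, reduceCtorEq, Sum.inl.injEq, false_or] at this
    obtain ⟨e, he, rfl⟩ := this
    rwa [G.rev_rev]

theorem mem_support_of_mem_turns (hp : G.IsWalk (G.face ds) p (G.face dt))
    {q : (D ⊕ D) × (D ⊕ D)} (hq : q ∈ G.turns ds dt p) :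
    G.base q.1 ∈ G.support (G.face ds) p := by
  rw [← map_base_turns hp]
  exact List.mem_map.2 ⟨q, hq, rfl⟩

theorem LeftOf.mem_support (hp : G.IsWalk (G.face ds) p (G.face dt)) {d : D}
    (h : G.LeftOf ds dt p d) : G.face d ∈ G.support (G.face ds) p := by
  obtain ⟨q, hq, hb⟩ := h
  have := mem_support_of_mem_turns hp hq
  rwa [← hb.base_eq] at this

theorem RightOf.mem_support (hp : G.IsWalk (G.face ds) p (G.face dt)) {d : D}
    (h : G.RightOf ds dt p d) : G.face d ∈ G.support (G.face ds) p := by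
  obtain ⟨q, hq, hb⟩ := h
  have := mem_support_of_mem_turns hp hq
  rwa [base_of_mem_turns hp hq, ← hb.base_eq] at this

theorem OnPath.mem_support (hp : G.IsWalk (G.face ds) p (G.face dt)) {d : D}
    (h : G.OnPath p d) : G.face d ∈ G.support (G.face ds) p := by
  rcases onPath_iff.1 h with h | h
  · obtain ⟨q, hq, he⟩ := mem_turns_next (G := G) (ds := ds) (dt := dt) h
    have := mem_support_of_mem_turns hp hq
    rwa [he] at this
  · obtain ⟨q, hq, he⟩ := mem_turns_prev (G := G) (ds := ds) (dt := dt) h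
    have := mem_support_of_mem_turns hp hq
    rwa [base_of_mem_turns hp hq, he] at this

theorem LeftOf.not_rightOf (hp : G.IsPath (G.face ds) p (G.face dt)) (hne : ds ≠ dt) {d : D}
    (h : G.LeftOf ds dt p d) : ¬ G.RightOf ds dt p d := by
  rintro ⟨q', hq', hb'⟩
  obtain ⟨q, hq, hb⟩ := h
  obtain rfl := eq_of_mem_turns hp hq hq' (by
    rw [base_of_mem_turns hp.1 hq', ← hb'.base_eq, ← hb.base_eq])
  exact G.not_between_and_between (ne_of_mem_turns hp hne hq) hb hb'

section Sides

variable [Finite D]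

theorem sides (hp : G.IsPath (G.face ds) p (G.face dt)) {d : D}
    (hd : G.face d ∈ G.support (G.face ds) p) :
    G.OnPath p d ∨ G.LeftOf ds dt p d ∨ G.RightOf ds dt p d := by
  rw [← map_base_turns hp.1, List.mem_map] at hd
  obtain ⟨q, hq, hb⟩ := hd
  by_cases h1 : Sum.inl d = q.1
  · exact Or.inl (onPath_of_mem_turns hq (Or.inl h1))
  by_cases h2 : Sum.inl d = q.2
  · exact Or.inl (onPath_of_mem_turns hq (Or.inr h2))
  rcases G.between_or_between (x := q.1) (z := q.2) (y := Sum.inl d) hb h1 h2 with h | h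
  · exact Or.inr (Or.inl ⟨q, hq, h⟩)
  · exact Or.inr (Or.inr ⟨q, hq, h⟩)

theorem not_between_of_onPath (hp : G.IsPath (G.face ds) p (G.face dt)) (hne : ds ≠ dt) {d : D}
    (h : G.OnPath p d) {q : (D ⊕ D) × (D ⊕ D)} (hq : q ∈ G.turns ds dt p) :
    ¬ G.Between q.1 (Sum.inl d) q.2 ∧ ¬ G.Between q.2 (Sum.inl d) q.1 := by
  by_cases hb : G.base q.1 = G.face d
  · have hq0 : Sum.inl d = q.1 ∨ Sum.inl d = q.2 := by
      rcases onPath_iff.1 h with h | h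
      · obtain ⟨q', hq', he⟩ := mem_turns_next (G := G) (ds := ds) (dt := dt) h
        obtain rfl := eq_of_mem_turns hp hq hq' (by rw [hb, he]; rfl)
        exact Or.inl he.symm
      · obtain ⟨q', hq', he⟩ := mem_turns_prev (G := G) (ds := ds) (dt := dt) h
        obtain rfl := eq_of_mem_turns hp hq hq' (by
          rw [base_of_mem_turns hp.1 hq', hb, he]; rfl)
        exact Or.inr he.symm
    have hne' := ne_of_mem_turns hp hne hq
    have hb' := base_of_mem_turns hp.1 hq
    rcases hq0 with h | h <;> rw [h]
    · exact ⟨G.not_between_left hb' hne', G.not_between_right⟩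
    · exact ⟨G.not_between_right, G.not_between_left hb'.symm hne'.symm⟩
  · refine ⟨fun h => hb h.base_eq.symm, fun h => hb ?_⟩
    rw [base_of_mem_turns hp.1 hq]
    exact h.base_eq.symm

theorem OnPath.not_leftOf (hp : G.IsPath (G.face ds) p (G.face dt)) (hne : ds ≠ dt) {d : D}
    (h : G.OnPath p d) : ¬ G.LeftOf ds dt p d :=
  fun ⟨_, hq, hb⟩ => (not_between_of_onPath hp hne h hq).1 hb

theorem OnPath.not_rightOf (hp : G.IsPath (G.face ds) p (G.face dt)) (hne : ds ≠ dt) {d : D}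
    (h : G.OnPath p d) : ¬ G.RightOf ds dt p d :=
  fun ⟨_, hq, hb⟩ => (not_between_of_onPath hp hne h hq).2 hb

end Sides

theorem sum_map_sub_list {α : Type*} (l : List α) (f g : α → ℝ) :
    (l.map fun x => f x - g x).sum = (l.map f).sum - (l.map g).sum := by
  induction l with
  | nil => simp
  | cons a l ih => simp only [List.map_cons, List.sum_cons, ih]; ring

open Classical in
/-- The indicator function of the darts on the left of the path. -/
noncomputable def leftInd (G : PlaneGraph D) (ds dt : D) (p : List D) (d : D) : ℤ :=
  if G.LeftOf ds dt p d then 1 else 0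

/-- A coboundary, summed over the darts on the left of the path. -/
theorem sum_leftInd_mul_coboundary [Fintype D] (hp : G.IsPath (G.face ds) p (G.face dt))
    (h : G.Vertex → ℝ) :
    ∑ d, (G.leftInd ds dt p d : ℝ) * (h (G.vertex (G.rev d)) - h (G.vertex d))
      = h (G.vertex ds) - h (G.vertex dt) := by
  classical
  have hnd : (G.turns ds dt p).Nodup :=
    List.Nodup.of_map (fun q => G.base q.1) (by rw [map_base_turns hp.1]; exact hp.2)
  have h1 : ∀ d, (G.leftInd ds dt p d : ℝ) * (h (G.vertex (G.rev d)) - h (G.vertex d))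
      = ∑ q ∈ (G.turns ds dt p).toFinset, if G.Between q.1 (Sum.inl d) q.2 then
          h (G.vertex (G.rev d)) - h (G.vertex d) else 0 := by
    intro d
    by_cases hd : G.LeftOf ds dt p d
    · obtain ⟨q, hq, hb⟩ := id hd
      rw [Finset.sum_eq_single q]
      · simp [leftInd, hd, hb]
      · intro q' hq' hqq'
        rw [if_neg]
        intro hb'
        exact hqq' (eq_of_mem_turns hp (List.mem_toFinset.1 hq') hq
          (hb'.base_eq.symm.trans hb.base_eq))
      · intro h; exact absurd (List.mem_toFinset.2 hq) h
    · rw [Finset.sum_eq_zero]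
      · simp [leftInd, hd]
      · intro q hq
        rw [if_neg]
        exact fun hb => hd ⟨q, List.mem_toFinset.1 hq, hb⟩
  simp only [h1]
  rw [Finset.sum_comm]
  have h2 : ∀ q ∈ (G.turns ds dt p).toFinset, (∑ d, if G.Between q.1 (Sum.inl d) q.2 then
          h (G.vertex (G.rev d)) - h (G.vertex d) else 0)
      = G.cornerValue h q.2 - G.cornerValue h (G.turn q.1) := fun q hq =>
    G.sum_between h (base_of_mem_turns hp.1 (List.mem_toFinset.1 hq))
  rw [Finset.sum_congr rfl h2, List.sum_toFinset _ hnd, sum_map_sub_list]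
  have h3 : (G.turns ds dt p).map (fun q => G.cornerValue h q.2)
      = (Sum.inr ds :: p.map (fun d => Sum.inl (G.rev d))).map (G.cornerValue h) := by
    rw [← Function.comp_def, ← List.map_map, turns, List.map_snd_zip (by simp)]
  have h4 : (G.turns ds dt p).map (fun q => G.cornerValue h (G.turn q.1))
      = (p.map Sum.inl ++ [Sum.inr dt]).map (G.cornerValue h ∘ G.turn) := by
    rw [show (fun q : (D ⊕ D) × (D ⊕ D) => G.cornerValue h (G.turn q.1))
      = (G.cornerValue h ∘ G.turn) ∘ Prod.fst from rfl, ← List.map_map, turns,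
      List.map_fst_zip (by simp)]
  rw [h3, h4]
  -- The corner just left of a path edge at its start and the one at its end belong to the same
  -- vertex of `G`, so all terms cancel except those of the two dummy edges.
  simp [cornerValue, turn, Function.comp_def, vertex_facePerm]
  ring

end PlaneGraph

/-! ### Intersection numbers of closed dual walks, and separation. -/

namespace PlaneGraph

variable {D : Type*} {G : PlaneGraph D} {ds dt : D} {p : List D}

/-! ### The algebraic number of intersections with the left side of a path -/

/-- The intersection number of the dual dart of `d` with a curve along the left side of the path
`p`: a dart that leaves the path to the left counts `1`, one that arrives from the left
counts `-1`. -/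
noncomputable def lam (G : PlaneGraph D) (ds dt : D) (p : List D) (d : D) : ℤ :=
  G.leftInd ds dt p d - G.leftInd ds dt p (G.rev d)

theorem lam_rev (d : D) : G.lam ds dt p (G.rev d) = -G.lam ds dt p d := by
  simp [lam, G.rev_rev]

theorem lam_of_onPath [Finite D] (hp : G.IsPath (G.face ds) p (G.face dt)) (hne : ds ≠ dt) {d : D}
    (h : G.OnPath p d) : G.lam ds dt p d = 0 := by
  simp [lam, leftInd, h.not_leftOf hp hne, (onPath_rev.2 h).not_leftOf hp hne]

open Classical in
/-- The chain of a sequence of darts. -/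
noncomputable def chain (G : PlaneGraph D) {ι : Type*} [Fintype ι] (c : ι → D) (d : D) : ℝ :=
  ∑ i, ((if c i = d then 1 else 0) - (if G.rev (c i) = d then 1 else 0))

theorem chain_rev {ι : Type*} [Fintype ι] (c : ι → D) (d : D) :
    G.chain c (G.rev d) = -G.chain c d := by
  classical
  rw [chain, chain, ← Finset.sum_neg_distrib]
  refine Finset.sum_congr rfl fun i _ => ?_
  have h1 : c i = G.rev d ↔ G.rev (c i) = d :=
    ⟨fun h => by rw [h, G.rev_rev], fun h => by rw [← h, G.rev_rev]⟩
  have h2 : G.rev (c i) = G.rev d ↔ c i = d := G.rev.injective.eq_iff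
  simp only [h1, h2]
  ring

theorem sum_chain_mul [Fintype D] {ι : Type*} [Fintype ι] (c : ι → D) (ψ : D → ℝ) :
    ∑ d, G.chain c d * ψ d = ∑ i, (ψ (c i) - ψ (G.rev (c i))) := by
  classical
  simp only [chain, Finset.sum_mul]
  rw [Finset.sum_comm]
  refine Finset.sum_congr rfl fun i _ => ?_
  simp only [sub_mul, Finset.sum_sub_distrib, ite_mul, one_mul, zero_mul, Finset.sum_ite_eq,
    Finset.mem_univ, if_true]

theorem sum_leftInd_mul_chain [Fintype D] {ι : Type*} [Fintype ι] (c : ι → D) :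
    ∑ d, (G.leftInd ds dt p d : ℝ) * G.chain c d = ((∑ i, G.lam ds dt p (c i) : ℤ) : ℝ) := by
  simp only [mul_comm (G.leftInd ds dt p _ : ℝ), sum_chain_mul, lam]
  push_cast
  rfl

theorem rev_eq_iff_of_isCycle {n : ℕ} {c : ZMod n → D} (hc : G.IsCycle c) (i j : ZMod n) :
   
    G.face (G.rev (c j)) = G.face (c i) ↔ j = i - 1 := by
  rw [hc.1, hc.2.1.eq_iff (a := j + 1) (b := i), eq_sub_iff_add_eq]

section Cycle

variable {n : ℕ} [NeZero n] {c : ZMod n → D}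

theorem chain_closed [Fintype D] (hc : ∀ i, G.face (G.rev (c i)) = G.face (c (i + 1)))
    (k : G.Face → ℝ) : ∑ d, G.chain c d * k (G.face d) = 0 := by
  rw [sum_chain_mul]
  simp only [hc, Finset.sum_sub_distrib, sub_eq_zero]
  exact (Equiv.sum_comp (Equiv.addRight (1 : ZMod n)) fun i => k (G.face (c i))).symm

theorem chain_eq_zero {ι : Type*} [Fintype ι] {c : ι → D} {d : D}
    (h : ∀ i, G.edge (c i) ≠ G.edge d) : G.chain c d = 0 := by
  classical
  refine Finset.sum_eq_zero fun i _ => ?_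
  have h1 : c i ≠ d := fun e => h i (by rw [e])
  have h2 : G.rev (c i) ≠ d := fun e => h i (by rw [← e, edge_rev])
  simp [h1, h2]

/-- A closed walk of the dual graph with nonzero intersection number separates. -/
theorem separates_of_sum_lam_ne_zero [Finite D] (hp : G.IsPath (G.face ds) p (G.face dt))
    (hc : ∀ i, G.face (G.rev (c i)) = G.face (c (i + 1)))
    (h : ∑ i, G.lam ds dt p (c i) ≠ 0) : G.Separates c (G.vertex ds) (G.vertex dt) := by
  have := Fintype.ofFinite D
  obtain ⟨φ, hφ⟩ := G.exists_potential (G.chain c) (chain_rev c) (chain_closed hc)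
  intro hr
  -- The intersection number is the potential difference between `s` and `t`. A walk of `G` that
  -- avoids the cycle keeps the potential constant, so the number would vanish.
  apply h
  have h1 := sum_leftInd_mul_coboundary hp φ
  simp only [← hφ, sum_leftInd_mul_chain] at h1
  have h2 : φ (G.vertex ds) = φ (G.vertex dt) := by
    generalize G.vertex dt = v at hr
    induction hr with
    | refl => rfl
    | tail _ hxy ih =>
      obtain ⟨d, rfl, rfl, hd⟩ := hxy
      have := hφ d
      rw [chain_eq_zero hd] at this
      linarith
  rw [h2, sub_self] at h1
  exact_mod_cast h1

/-- A separating cycle has intersection number `1` or `-1`. -/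
theorem sum_lam_of_isSepCycle [Finite D] (hp : G.IsPath (G.face ds) p (G.face dt))
    (hc : G.IsSepCycle (G.vertex ds) (G.vertex dt) c) :
    ∑ i, G.lam ds dt p (c i) = 1 ∨ ∑ i, G.lam ds dt p (c i) = -1 := by
  classical
  have := Fintype.ofFinite D
  obtain ⟨hc, hs⟩ := hc
  -- The side of `s`: its indicator `φ` has a coboundary `b` supported on the edges of the cycle.
  let S : Set G.Vertex := {v | Relation.ReflTransGen
    (fun u v => ∃ d, G.vertex d = u ∧ G.vertex (G.rev d) = v ∧ ∀ i, G.edge (c i) ≠ G.edge d)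
    (G.vertex ds) v}
  let φ : G.Vertex → ℤ := fun v => if v ∈ S then 1 else 0
  have hφs : φ (G.vertex ds) = 1 := if_pos Relation.ReflTransGen.refl
  have hφt : φ (G.vertex dt) = 0 := if_neg hs
  let b : D → ℤ := fun d => φ (G.vertex (G.rev d)) - φ (G.vertex d)
  have hbrev : ∀ d, b (G.rev d) = -b d := fun d => by simp [b, G.rev_rev]
  have hb0 : ∀ d, (∀ i, G.edge (c i) ≠ G.edge d) → b d = 0 := by
    intro d hd
    have h1 : G.vertex d ∈ S ↔ G.vertex (G.rev d) ∈ S :=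
      ⟨fun h => h.tail ⟨d, rfl, rfl, hd⟩,
        fun h => h.tail ⟨G.rev d, rfl, by rw [G.rev_rev], by simpa only [edge_rev] using hd⟩⟩
    simp [b, φ, h1]
  have hclosed := G.sum_coboundary_mul_face (fun v => (φ v : ℝ))
  have hbstep : ∀ i, b (c i) = b (c (i - 1)) := by
    intro i
    -- Testing closedness at a single dual vertex of the cycle: only the two cycle edges there
    -- contribute, so `b` passes unchanged from one to the next.
    have h1 := hclosed (fun f => if f = G.face (c i) then 1 else 0)
    have hnn : c i ≠ G.rev (c (i - 1)) := hc.2.2 _ _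
    have h2 : ∑ d ∈ {c i, G.rev (c (i - 1))}, (b d : ℝ) = 0 := by
      rw [← h1]
      simp only [mul_ite, mul_one, mul_zero]
      rw [← Finset.sum_filter]
      have : ∀ d, ((φ (G.vertex (G.rev d)) : ℝ) - φ (G.vertex d)) = (b d : ℝ) := fun d => by
        simp [b]
      simp only [this]
      refine Finset.sum_subset ?_ ?_
      · intro d hd
        simp only [Finset.mem_insert, Finset.mem_singleton] at hd
        simp only [Finset.mem_filter, Finset.mem_univ, true_and]
        rcases hd with rfl | rfl
        · rfl
        · exact (rev_eq_iff_of_isCycle hc _ _).2 rfl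
      · intro d hd hd'
        simp only [Finset.mem_filter, Finset.mem_univ, true_and] at hd
        simp only [Finset.mem_insert, Finset.mem_singleton, not_or] at hd'
        rw [hb0 d, Int.cast_zero]
        intro j hj
        rcases (G.edge_eq_iff _ _).1 hj.symm with rfl | rfl
        · exact hd'.1 (by rw [hc.2.1 hd])
        · exact hd'.2 (by rw [(rev_eq_iff_of_isCycle hc _ _).1 hd])
    rw [Finset.sum_pair hnn, hbrev] at h2
    push_cast at h2
    have h3 : (b (c i) : ℝ) = b (c (i - 1)) := by linarith
    exact_mod_cast h3
  have hbconst : ∀ i, b (c i) = b (c 0) := by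
    have : ∀ k : ℕ, b (c (k : ZMod n)) = b (c 0) := by
      intro k
      induction k with
      | zero => simp
      | succ k ih => rw [hbstep, ← ih]; push_cast; rw [add_sub_cancel_right]
    intro i
    rw [← ZMod.natCast_zmod_val i, this]
  -- Thus `b` is an integer multiple of the chain of `c`. The potential drop from `s` to `t` is 1,
  -- so this integer times the intersection number is 1, and both are units.
  have hbchain : ∀ d, (b d : ℝ) = b (c 0) * G.chain c d := by
    intro d
    by_cases hd : ∀ i, G.edge (c i) ≠ G.edge d
    · rw [hb0 d hd, chain_eq_zero hd]; simp
    · push Not at hd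
      obtain ⟨i, hi⟩ := hd
      have hci : G.chain c (c i) = 1 := by
        rw [chain, Finset.sum_eq_single i]
        · simp [G.rev_ne]
        · intro j _ hj
          have h1 : c j ≠ c i := fun e => hj (hc.2.1 (by simp only [e]))
          simp [h1, (hc.2.2 i j).symm]
        · simp
      rcases (G.edge_eq_iff _ _).1 hi.symm with rfl | rfl
      · rw [hci, hbconst, mul_one]
      · rw [chain_rev, hci, hbrev, hbconst]; push_cast; ring
  have h1 := sum_leftInd_mul_coboundary hp (fun v => (φ v : ℝ))
  have h2 : ∀ d, ((φ (G.vertex (G.rev d)) : ℝ) - φ (G.vertex d)) = b (c 0) * G.chain c d :=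
    fun d => by rw [← hbchain]; simp [b]
  simp only [h2, mul_left_comm _ (b (c 0) : ℝ), ← Finset.mul_sum, sum_leftInd_mul_chain, hφs,
    hφt] at h1
  have h3 : b (c 0) * ∑ i, G.lam ds dt p (c i) = 1 := by
    exact_mod_cast (by simpa using h1 :
      (b (c 0) : ℝ) * ((∑ i, G.lam ds dt p (c i) : ℤ) : ℝ) = 1)
  exact Int.isUnit_iff.1 (IsUnit.of_mul_eq_one _ (by rw [mul_comm]; exact h3))

end Cycle

end PlaneGraph

/-! ### Lengths and intersection numbers of walks. -/

namespace PlaneGraph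

variable {D : Type*} {G : PlaneGraph D} {ds dt : D} {p : List D} {w : G.Edge → ℝ}

/-! ### Walks -/

theorem isWalk_append {f g : G.Face} {a b : List D} :
    G.IsWalk f (a ++ b) g ↔ ∃ h, G.IsWalk f a h ∧ G.IsWalk h b g := by
  induction a generalizing f with
  | nil => simp [IsWalk]
  | cons d a ih => simp [IsWalk, ih, and_assoc]

theorem isWalk_reverse {f g : G.Face} {a : List D} (h : G.IsWalk f a g) :
    G.IsWalk g (a.map G.rev).reverse f := by
  induction a generalizing f with
  | nil => exact h.symm
  | cons d a ih =>
    rw [List.map_cons, List.reverse_cons, isWalk_append]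
    exact ⟨_, ih h.2, rfl, by rw [G.rev_rev]; exact h.1⟩

theorem isWalk_unique {f g g' : G.Face} {a : List D} (h : G.IsWalk f a g)
    (h' : G.IsWalk f a g') : g = g' := by
  induction a generalizing f with
  | nil => exact h.symm.trans h'
  | cons d a ih => exact ih h.2 h'.2

theorem pathLength_append (a b : List D) :
    G.pathLength w (a ++ b) = G.pathLength w a + G.pathLength w b := by
  simp [pathLength]

theorem pathLength_cons (d : D) (a : List D) :
    G.pathLength w (d :: a) = w (G.edge d) + G.pathLength w a := by
  simp [pathLength]

theorem pathLength_reverse (a : List D) :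
    G.pathLength w (a.map G.rev).reverse = G.pathLength w a := by
  simp [pathLength, List.sum_reverse, Function.comp_def, edge_rev]

theorem pathLength_nonneg (hw : ∀ e, 0 < w e) (a : List D) : 0 ≤ G.pathLength w a :=
  List.sum_nonneg (by simpa using fun d _ => (hw (G.edge d)).le)

theorem pathLength_pos (hw : ∀ e, 0 < w e) {a : List D} (ha : a ≠ []) :
    0 < G.pathLength w a := by
  obtain ⟨d, a, rfl⟩ := List.exists_cons_of_ne_nil ha
  rw [pathLength_cons]
  have := hw (G.edge d)
  have := pathLength_nonneg hw a
  linarith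

/-- The intersection number of a walk with the left side of the path `p`. -/
noncomputable def lamSum (G : PlaneGraph D) (ds dt : D) (p : List D) (a : List D) : ℤ :=
  (a.map (G.lam ds dt p)).sum

theorem lamSum_append (a b : List D) :
    G.lamSum ds dt p (a ++ b) = G.lamSum ds dt p a + G.lamSum ds dt p b := by
  simp [lamSum]

theorem lamSum_reverse (a : List D) :
    G.lamSum ds dt p (a.map G.rev).reverse = -G.lamSum ds dt p a := by
  induction a with
  | nil => simp [lamSum]
  | cons d a ih =>
    rw [List.map_cons, List.reverse_cons, lamSum_append, ih]
    simp [lamSum, lam_rev]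

theorem lamSum_eq_zero [Finite D] (hp : G.IsPath (G.face ds) p (G.face dt)) (hne : ds ≠ dt)
    {a : List D} (ha : ∀ d ∈ a, G.OnPath p d) : G.lamSum ds dt p a = 0 := by
  refine List.sum_eq_zero fun x hx => ?_
  obtain ⟨d, hd, rfl⟩ := List.mem_map.1 hx
  exact lam_of_onPath hp hne (ha d hd)

theorem isWalk_of_getElem?_support {f g u : G.Face} {q : List D} (h : G.IsWalk f q g) {k : ℕ}
    (hk : (G.support f q)[k]? = some u) :
    k ≤ q.length ∧ G.IsWalk f (q.take k) u ∧ G.IsWalk u (q.drop k) g := by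
  induction q generalizing f k with
  | nil =>
    rcases k with _ | k
    · simp only [support, List.map_nil, List.getElem?_cons_zero, Option.some.injEq] at hk
      subst hk
      exact ⟨le_rfl, rfl, h⟩
    · simp [support] at hk
  | cons d q ih =>
    rcases k with _ | k
    · simp only [support, List.getElem?_cons_zero, Option.some.injEq] at hk
      subst hk
      exact ⟨Nat.zero_le _, rfl, h⟩
    · obtain ⟨h1, h2, h3⟩ := ih h.2 (k := k) (by simpa [support] using hk)
      exact ⟨Nat.succ_le_succ h1, ⟨h.1, h2⟩, h3⟩

theorem face_getElem {f g : G.Face} {q : List D} (h : G.IsWalk f q g) {k : ℕ}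
    (hk : k < q.length) : (G.support f q)[k]? = some (G.face q[k]) := by
  induction q generalizing f k with
  | nil => simp at hk
  | cons d q ih =>
    rcases k with _ | k
    · simp [support, h.1]
    · simpa [support] using ih h.2 (k := k) (by simpa using hk)

theorem face_rev_getElem {f : G.Face} {q : List D} {k : ℕ} (hk : k < q.length) :
    (G.support f q)[k + 1]? = some (G.face (G.rev q[k])) := by
  simp [support, hk]

theorem getElem?_support_length {f g : G.Face} {q : List D} (h : G.IsWalk f q g) :
    (G.support f q)[q.length]? = some g := by
  induction q generalizing f with
  | nil => simpa [support, IsWalk] using h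
  | cons d q ih => simpa [support] using ih h.2

/-! ### Closed walks -/

/-- Cutting at two visits to the same face splits off the nonempty closed piece `B`. What remains is
nonempty as well, since the second visit is the start of an edge of `W`; both pieces are shorter, as
the induction on length requires. -/
theorem exists_closed_subwalk {f g : G.Face} {W : List D} (hW : G.IsWalk f W g)
    (hnd : ¬ (W.map G.face).Nodup) :
    ∃ (A B C : List D) (h : G.Face), W = A ++ B ++ C ∧ G.IsWalk f (A ++ C) g ∧ G.IsWalk h B h ∧
      B ≠ [] ∧ A ++ C ≠ [] := by
  rw [List.nodup_iff_pairwise_ne, List.pairwise_iff_getElem] at hnd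
  push Not at hnd
  obtain ⟨i, j, hi, hj, hij, he⟩ := hnd
  simp only [List.length_map] at hi hj
  simp only [List.getElem_map] at he
  obtain ⟨-, h1, h2⟩ := isWalk_of_getElem?_support hW (face_getElem hW hi)
  obtain ⟨-, h3, h4⟩ := isWalk_of_getElem?_support hW (face_getElem hW hj)
  have e1 : W.take j = W.take i ++ (W.drop i).take (j - i) := by
    rw [← List.take_add, Nat.add_sub_cancel' hij.le]
  refine ⟨W.take i, (W.drop i).take (j - i), W.drop j, G.face W[i], ?_, ?_, ?_, ?_, ?_⟩
  · rw [← e1, List.take_append_drop]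
  · rw [isWalk_append]
    exact ⟨_, h1, by rw [he]; exact h4⟩
  · rw [e1, isWalk_append] at h3
    obtain ⟨h, h5, h6⟩ := h3
    obtain rfl := isWalk_unique h5 h1
    rwa [← he] at h6
  · intro h
    have := congrArg List.length h
    simp only [List.length_take, List.length_drop, List.length_nil] at this
    omega
  · intro h
    have := congrArg List.length h
    simp only [List.length_append, List.length_take, List.length_drop, List.length_nil] at this
    omega

/-- A closed walk without repeated vertices is a cycle, unless it goes back and forth along
an edge. -/
theorem exists_cycle_of_nodup {f : G.Face} {W : List D} (hW : G.IsWalk f W f)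
    (hnd : (W.map G.face).Nodup) (hne : W ≠ []) (hs : G.lamSum ds dt p W ≠ 0) :
    ∃ (m : ℕ) (_ : NeZero m) (c : ZMod m → D), G.IsCycle c ∧
      ∑ i, G.lam ds dt p (c i) = G.lamSum ds dt p W ∧ G.cycleLength w c = G.pathLength w W := by
  obtain ⟨k, hk⟩ : ∃ k, W.length = k + 1 :=
    Nat.exists_eq_succ_of_ne_zero (fun h => hne (List.length_eq_zero_iff.1 h))
  let c : ZMod (k + 1) → D := fun i => W[i.val]'(by rw [hk]; exact ZMod.val_lt i)
  have hsum : ∀ {M : Type} [AddCommMonoid M] (F : D → M), ∑ i, F (c i) = (W.map F).sum := by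
    intro M _ F
    rw [← Fin.sum_univ_fun_getElem]
    exact Fintype.sum_equiv (finCongr hk.symm) _ _ (fun i => rfl)
  have hstep : ∀ i, G.face (G.rev (c i)) = G.face (c (i + 1)) := by
    intro i
    have hi := ZMod.val_lt i
    apply Option.some.inj
    rw [← face_rev_getElem (f := f)]
    by_cases h : i.val + 1 < k + 1
    · have h1 : (i + 1).val = i.val + 1 := by
        have : i + 1 = ((i.val + 1 : ℕ) : ZMod (k + 1)) := by
          rw [Nat.cast_add, ZMod.natCast_zmod_val, Nat.cast_one]
        rw [this, ZMod.val_natCast_of_lt h]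
      simp only [c, h1]
      have h2 : i.val + 1 < W.length := by omega
      exact face_getElem hW h2
    · have h1 : i.val + 1 = W.length := by omega
      have h2 : i + 1 = 0 := by
        have : i + 1 = ((i.val + 1 : ℕ) : ZMod (k + 1)) := by
          rw [Nat.cast_add, ZMod.natCast_zmod_val, Nat.cast_one]
        rw [this]
        exact (ZMod.natCast_eq_zero_iff _ _).2 ⟨1, by omega⟩
      simp only [h1, h2, getElem?_support_length hW, c, ZMod.val_zero]
      have h3 : 0 < W.length := by omega
      exact face_getElem hW h3
  have hinj : Function.Injective fun i => G.face (c i) := by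
    intro i j hij
    have hi : i.val < (W.map G.face).length := by
      rw [List.length_map, hk]; exact ZMod.val_lt i
    have hj : j.val < (W.map G.face).length := by
      rw [List.length_map, hk]; exact ZMod.val_lt j
    apply ZMod.val_injective
    refine (hnd.getElem_inj_iff (hi := hi) (hj := hj)).1 ?_
    simpa using hij
  refine ⟨k + 1, inferInstance, c, ⟨hstep, hinj, fun i j hij => hs ?_⟩, hsum _,
    hsum fun d => w (G.edge d)⟩
  -- An edge used in both directions forces the cycle to consist of `c i` and `c j` only, whose
  -- intersection numbers cancel, against `hs`.
  have h1 : j + 1 = i := hinj (by simp only [← hstep, hij])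
  have h2 : i + 1 = j := hinj (by simp only [← hstep, hij, G.rev_rev])
  have h3 : ((2 : ℕ) : ZMod (k + 1)) = 0 := by
    have : j + (2 : ℕ) = j := by push_cast; rw [← one_add_one_eq_two, ← add_assoc, h1, h2]
    simpa using this
  have h4 := Nat.le_of_dvd (by norm_num) ((ZMod.natCast_eq_zero_iff _ _).1 h3)
  have hlen : (Finset.univ : Finset (ZMod (k + 1))) = {i, j} := by
    symm
    have hij' : i ≠ j := by rintro rfl; exact G.rev_ne _ hij.symm
    rw [← Finset.card_eq_iff_eq_univ, Finset.card_pair hij', ZMod.card]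
    have : 1 < Fintype.card (ZMod (k + 1)) := Fintype.one_lt_card_iff.2 ⟨i, j, hij'⟩
    rw [ZMod.card] at this
    omega
  have hij' : i ≠ j := by rintro rfl; exact G.rev_ne _ hij.symm
  rw [lamSum, ← hsum, hlen, Finset.sum_pair hij', hij, lam_rev]
  simp

/-- A closed walk decomposes into simple closed ones, and both sides behave well: lengths add up,
absolute values are subadditive. A simple piece with nonzero number is a separating cycle, with
number ±1 and length at least `ℓ`. -/
theorem abs_lamSum_mul_le [Finite D] (hp : G.IsPath (G.face ds) p (G.face dt))
    (hw : ∀ e, 0 < w e) {ℓ : ℝ} (hℓ : 0 ≤ ℓ)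
    (hmin : ∀ (m : ℕ) [NeZero m] (c : ZMod m → D), G.IsSepCycle (G.vertex ds) (G.vertex dt) c →
      ℓ ≤ G.cycleLength w c) {f : G.Face} {W : List D} (hW : G.IsWalk f W f) :
    |(G.lamSum ds dt p W : ℝ)| * ℓ ≤ G.pathLength w W := by
  induction hl : W.length using Nat.strong_induction_on generalizing f W with
  | _ N ih =>
  by_cases hs : G.lamSum ds dt p W = 0
  · simpa [hs] using pathLength_nonneg hw W
  by_cases hnd : (W.map G.face).Nodup
  · have hne : W ≠ [] := by rintro rfl; exact hs rfl
    obtain ⟨m, _, c, hc, h1, h2⟩ := exists_cycle_of_nodup (w := w) hW hnd hne hs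
    have hsep : G.IsSepCycle (G.vertex ds) (G.vertex dt) c :=
      ⟨hc, separates_of_sum_lam_ne_zero hp hc.1 (by rwa [h1])⟩
    have h3 := hmin m c hsep
    rw [h2] at h3
    rcases sum_lam_of_isSepCycle hp hsep with h | h <;> rw [h1] at h <;> simpa [h] using h3
  · obtain ⟨A, B, C, g, rfl, hAC, hB, hB0, hAC0⟩ := exists_closed_subwalk hW hnd
    simp only [ne_eq, ← List.length_eq_zero_iff, List.length_append] at hB0 hAC0 hl
    have h1 := ih _ (by simp only [List.length_append]; omega) hAC rfl
    have h2 := ih _ (by omega) hB rfl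
    have h3 : G.lamSum ds dt p (A ++ B ++ C)
        = G.lamSum ds dt p (A ++ C) + G.lamSum ds dt p B := by
      simp only [lamSum_append]; ring
    have h4 : G.pathLength w (A ++ B ++ C) = G.pathLength w (A ++ C) + G.pathLength w B := by
      simp only [pathLength_append]; ring
    rw [h3, h4]
    push_cast
    have := abs_add_le (G.lamSum ds dt p (A ++ C) : ℝ) (G.lamSum ds dt p B : ℝ)
    nlinarith

/-! ### Shortest walks -/

/-- `q` is a shortest walk from `f` to `g`. -/
def IsMinWalk (G : PlaneGraph D) (w : G.Edge → ℝ) (f : G.Face) (q : List D) (g : G.Face) : Prop :=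
  G.IsWalk f q g ∧ ∀ r, G.IsWalk f r g → G.pathLength w q ≤ G.pathLength w r

theorem exists_suffix_path {f g h : G.Face} {q : List D} (hq : G.IsPath f q g)
    (hh : h ∈ G.support f q) (hw : ∀ e, 0 < w e) :
    ∃ r, G.IsPath h r g ∧ G.pathLength w r ≤ G.pathLength w q := by
  induction q generalizing f with
  | nil =>
    simp only [support, List.map_nil, List.mem_singleton] at hh
    subst hh
    exact ⟨[], hq, le_rfl⟩
  | cons d q ih =>
    by_cases hf : h = f
    · subst hf; exact ⟨_, hq, le_rfl⟩
    · have hq' : G.IsPath (G.face (G.rev d)) q g :=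
        ⟨hq.1.2, (List.nodup_cons.1 hq.2).2⟩
      obtain ⟨r, hr, hle⟩ := ih hq' ((List.mem_cons.1 hh).resolve_left hf)
      refine ⟨r, hr, hle.trans ?_⟩
      rw [pathLength_cons]
      have := hw (G.edge d)
      linarith

/-- Removing loops does not increase the length. Thus shortest paths also minimize over walks, and
concatenations can be compared without checking simplicity. -/
theorem exists_path_of_walk {f g : G.Face} {q : List D} (hq : G.IsWalk f q g)
    (hw : ∀ e, 0 < w e) : ∃ r, G.IsPath f r g ∧ G.pathLength w r ≤ G.pathLength w q := by
  induction q generalizing f with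
  | nil => exact ⟨[], ⟨hq, by simp [support]⟩, le_rfl⟩
  | cons d q ih =>
    obtain ⟨r, hr, hle⟩ := ih hq.2
    have := hw (G.edge d)
    by_cases hf : f ∈ G.support (G.face (G.rev d)) r
    · obtain ⟨r', hr', hle'⟩ := exists_suffix_path hr hf hw
      refine ⟨r', hr', ?_⟩
      rw [pathLength_cons]
      linarith
    · refine ⟨d :: r, ⟨⟨hq.1, hr.1⟩, List.nodup_cons.2 ⟨hf, hr.2⟩⟩, ?_⟩
      rw [pathLength_cons, pathLength_cons]
      linarith

theorem IsShortestPath.isMinWalk {f g : G.Face} {q : List D} (hq : G.IsShortestPath w f q g)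
    (hw : ∀ e, 0 < w e) : G.IsMinWalk w f q g := by
  refine ⟨hq.1.1, fun r hr => ?_⟩
  obtain ⟨r', hr', hle⟩ := exists_path_of_walk hr hw
  exact (hq.2 r' hr').trans hle

theorem IsMinWalk.reverse {f g : G.Face} {q : List D} (hq : G.IsMinWalk w f q g) :
    G.IsMinWalk w g (q.map G.rev).reverse f := by
  refine ⟨isWalk_reverse hq.1, fun r hr => ?_⟩
  rw [pathLength_reverse, ← pathLength_reverse r]
  exact hq.2 _ (isWalk_reverse hr)

theorem IsMinWalk.length_eq {f g : G.Face} {q r : List D} (hq : G.IsMinWalk w f q g)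
    (hr : G.IsMinWalk w f r g) : G.pathLength w q = G.pathLength w r :=
  le_antisymm (hq.2 r hr.1) (hr.2 q hq.1)

theorem IsMinWalk.segment {f g u v : G.Face} {q : List D} (hq : G.IsMinWalk w f q g) {k l : ℕ}
    (hkl : k ≤ l) (hu : (G.support f q)[k]? = some u) (hv : (G.support f q)[l]? = some v) :
    ∃ r, G.IsMinWalk w u r v ∧ (∀ d ∈ r, d ∈ q) ∧
      G.pathLength w r = G.pathLength w (q.take l) - G.pathLength w (q.take k) := by
  obtain ⟨-, h1, -⟩ := isWalk_of_getElem?_support hq.1 hu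
  obtain ⟨-, h3, h4⟩ := isWalk_of_getElem?_support hq.1 hv
  have e1 : q.take l = q.take k ++ (q.drop k).take (l - k) := by
    rw [← List.take_add, Nat.add_sub_cancel' hkl]
  refine ⟨(q.drop k).take (l - k), ⟨?_, fun r hr => ?_⟩, ?_, ?_⟩
  · rw [e1, isWalk_append] at h3
    obtain ⟨h, h5, h6⟩ := h3
    rwa [isWalk_unique h1 h5]
  · have h6 : G.pathLength w q = G.pathLength w (q.take k)
        + G.pathLength w ((q.drop k).take (l - k)) + G.pathLength w (q.drop l) := by
      rw [← pathLength_append, ← pathLength_append, ← e1, List.take_append_drop]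
    have h7 := hq.2 (q.take k ++ r ++ q.drop l)
      (isWalk_append.2 ⟨_, isWalk_append.2 ⟨_, h1, hr⟩, h4⟩)
    simp only [pathLength_append] at h7
    linarith
  · exact fun d hd => List.mem_of_mem_drop (List.mem_of_mem_take hd)
  · rw [e1, pathLength_append]; ring

/-- Positions on shortest walks are determined by distances. -/
theorem IsMinWalk.abs_sub_eq {f₁ g₁ f₂ g₂ u v : G.Face} {q r : List D}
    (hq : G.IsMinWalk w f₁ q g₁) (hr : G.IsMinWalk w f₂ r g₂) {i j k l : ℕ}
    (hi : (G.support f₁ q)[i]? = some u) (hj : (G.support f₁ q)[j]? = some v)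
    (hk : (G.support f₂ r)[k]? = some u) (hl : (G.support f₂ r)[l]? = some v)
    (hw : ∀ e, 0 < w e) :
    |G.pathLength w (q.take i) - G.pathLength w (q.take j)|
      = |G.pathLength w (r.take k) - G.pathLength w (r.take l)| := by
  have key : ∀ {f g : G.Face} {q : List D}, G.IsMinWalk w f q g → ∀ {i j : ℕ},
      (G.support f q)[i]? = some u → (G.support f q)[j]? = some v →
      ∃ a, G.IsMinWalk w u a v ∧
        |G.pathLength w (q.take i) - G.pathLength w (q.take j)| = G.pathLength w a := by
    intro f g q hq i j hi hj
    rcases le_total i j with h | h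
    · obtain ⟨a, ha, -, h1⟩ := hq.segment h hi hj
      refine ⟨a, ha, ?_⟩
      rw [abs_sub_comm, ← h1, abs_of_nonneg (pathLength_nonneg hw a)]
    · obtain ⟨a, ha, -, h1⟩ := hq.segment h hj hi
      refine ⟨_, ha.reverse, ?_⟩
      rw [← h1, pathLength_reverse, abs_of_nonneg (pathLength_nonneg hw a)]
  obtain ⟨a, ha, h1⟩ := key hq hi hj
  obtain ⟨b, hb, h2⟩ := key hr hk hl
  rw [h1, h2, ha.length_eq hb]

theorem IsMinWalk.exists_onPath {f g u v : G.Face} (hp : G.IsMinWalk w f p g)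
    (hu : u ∈ G.support f p) (hv : v ∈ G.support f p) :
    ∃ r, G.IsMinWalk w u r v ∧ ∀ d ∈ r, G.OnPath p d := by
  obtain ⟨i, hi⟩ := List.mem_iff_getElem?.1 hu
  obtain ⟨j, hj⟩ := List.mem_iff_getElem?.1 hv
  rcases le_total i j with h | h
  · obtain ⟨a, ha, h1, -⟩ := hp.segment h hi hj
    exact ⟨a, ha, fun d hd => ⟨d, h1 d hd, rfl⟩⟩
  · obtain ⟨a, ha, h1, -⟩ := hp.segment h hj hi
    refine ⟨_, ha.reverse, fun d hd => ?_⟩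
    rw [List.mem_reverse, List.mem_map] at hd
    obtain ⟨e, he, rfl⟩ := hd
    exact ⟨e, h1 e he, G.edge_rev e⟩

theorem lt_iff_pathLength_take_lt (hw : ∀ e, 0 < w e) {q : List D} {i j : ℕ}
    (hi : i ≤ q.length) (hj : j ≤ q.length) :
    i < j ↔ G.pathLength w (q.take i) < G.pathLength w (q.take j) := by
  have key : ∀ {i j : ℕ}, i < j → j ≤ q.length →
      G.pathLength w (q.take i) < G.pathLength w (q.take j) := by
    intro i j hij hj
    have e1 : q.take j = q.take i ++ (q.drop i).take (j - i) := by
      rw [← List.take_add, Nat.add_sub_cancel' hij.le]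
    rw [e1, pathLength_append]
    have : (q.drop i).take (j - i) ≠ [] := by
      intro h
      have := congrArg List.length h
      simp only [List.length_take, List.length_drop, List.length_nil] at this
      omega
    have := pathLength_pos hw this
    linarith
  refine ⟨fun h => key h hj, fun h => ?_⟩
  by_contra hij
  rcases (not_lt.1 hij).eq_or_lt with rfl | hij
  · exact lt_irrefl _ h
  · exact lt_asymm h (key hij hi)

end PlaneGraph

/-! ### Arcs of the shortest separating cycle between vertices of the path. -/

namespace PlaneGraph

variable {D : Type*} {G : PlaneGraph D} {ds dt : D} {p : List D} {w : G.Edge → ℝ}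

/-! ### Arcs of cycles -/

theorem arc_add {n : ℕ} (c : ZMod n → D) (i : ZMod n) (k l : ℕ) :
    arc c i (k + l) = arc c i k ++ arc c (i + k) l := by
  simp [arc, List.range_add, Function.comp_def, add_assoc]

theorem arc_one {n : ℕ} (c : ZMod n → D) (i : ZMod n) : arc c i 1 = [c i] := by
  simp [arc]

theorem length_arc {n : ℕ} (c : ZMod n → D) (i : ZMod n) (k : ℕ) : (arc c i k).length = k := by
  simp [arc]

theorem isWalk_arc {n : ℕ} {c : ZMod n → D}
    (hc : ∀ i, G.face (G.rev (c i)) = G.face (c (i + 1))) (i : ZMod n) (k : ℕ) :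
    G.IsWalk (G.face (c i)) (arc c i k) (G.face (c (i + k))) := by
  induction k with
  | zero => simp [arc, IsWalk]
  | succ k ih =>
    rw [arc_add, isWalk_append, arc_one]
    refine ⟨_, ih, rfl, ?_⟩
    rw [hc, IsWalk]
    push_cast
    rw [add_assoc]

theorem getElem?_support_arc {n : ℕ} {c : ZMod n → D}
    (hc : ∀ i, G.face (G.rev (c i)) = G.face (c (i + 1))) (i : ZMod n) {k u : ℕ} (hu : u ≤ k) :
    (G.support (G.face (c i)) (arc c i k))[u]? = some (G.face (c (i + u))) := by
  rcases hu.eq_or_lt with rfl | hu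
  · have := getElem?_support_length (isWalk_arc hc i u)
    rwa [length_arc] at this
  · rw [face_getElem (isWalk_arc hc i k) (by rwa [length_arc])]
    simp [arc]

theorem isPath_arc {n : ℕ} [NeZero n] {c : ZMod n → D} (hc : G.IsCycle c) (i : ZMod n) {k : ℕ}
    (hk : k < n) : G.IsPath (G.face (c i)) (arc c i k) (G.face (c (i + k))) := by
  refine ⟨isWalk_arc hc.1 i k, ?_⟩
  rw [List.nodup_iff_pairwise_ne, List.pairwise_iff_getElem]
  intro a b ha hb hab h
  have hb' : b ≤ k := by
    simp only [support, List.length_cons, List.length_map, length_arc] at hb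
    omega
  have h1 := getElem?_support_arc hc.1 i (hab.le.trans hb')
  have h2 := getElem?_support_arc hc.1 i hb'
  rw [List.getElem?_eq_getElem ha, Option.some.injEq] at h1
  rw [List.getElem?_eq_getElem hb, Option.some.injEq] at h2
  rw [h1, h2] at h
  have h3 : (a : ZMod n) = b := add_left_cancel (hc.2.1 h)
  have h4 := congrArg ZMod.val h3
  rw [ZMod.val_natCast_of_lt (by omega), ZMod.val_natCast_of_lt (by omega)] at h4
  omega

theorem sum_map_arc {M : Type*} [AddCommMonoid M] {n : ℕ} [NeZero n] (c : ZMod n → D)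
    (i : ZMod n) (F : D → M) : ((arc c i n).map F).sum = ∑ j, F (c j) := by
  rw [arc, List.map_map, ← List.sum_toFinset _ List.nodup_range,
    List.toFinset_range]
  refine Finset.sum_nbij' (fun u : ℕ => i + (u : ZMod n)) (fun j => (j - i).val) ?_ ?_ ?_ ?_ ?_
  · simp
  · intro j _; simpa using ZMod.val_lt (j - i)
  · intro u hu
    simp [ZMod.val_natCast_of_lt (Finset.mem_range.1 hu)]
  · intro j _; simp
  · simp

/-- The data of the theorem: a shortest path `p` between faces at `s` and `t`, and a shortest
cycle `c` that separates `s` from `t`. -/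
structure Configuration (G : PlaneGraph D) (w : G.Edge → ℝ) (ds dt : D) (p : List D)
    {n : ℕ} [NeZero n] (c : ZMod n → D) : Prop where
  pos : ∀ e, 0 < w e
  ne : ds ≠ dt
  path : G.IsShortestPath w (G.face ds) p (G.face dt)
  cycle : G.IsShortestSepCycle w (G.vertex ds) (G.vertex dt) c

/-- The index `i` is the position on `c` of a vertex of `p`. -/
def Meets (G : PlaneGraph D) (ds : D) (p : List D) {n : ℕ} (c : ZMod n → D) (i : ZMod n) : Prop :=
  G.face (c i) ∈ G.support (G.face ds) p

/-- The intersection number of an arc of `c` with the left side of `p`. -/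
noncomputable def arcSum (G : PlaneGraph D) (ds dt : D) (p : List D) {n : ℕ} (c : ZMod n → D)
    (i : ZMod n) (k : ℕ) : ℤ :=
  G.lamSum ds dt p (arc c i k)

theorem arcSum_add {n : ℕ} (c : ZMod n → D) (i : ZMod n) (k l : ℕ) :
    G.arcSum ds dt p c i (k + l) = G.arcSum ds dt p c i k + G.arcSum ds dt p c (i + k) l := by
  rw [arcSum, arc_add, lamSum_append]; rfl

theorem arcSum_one {n : ℕ} (c : ZMod n → D) (i : ZMod n) :
    G.arcSum ds dt p c i 1 = G.lam ds dt p (c i) := by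
  simp [arcSum, arc_one, lamSum]

theorem arcSum_zero {n : ℕ} (c : ZMod n → D) (i : ZMod n) :
    G.arcSum ds dt p c i 0 = 0 := by
  simp [arcSum, arc, lamSum]

namespace Configuration

variable {n : ℕ} [NeZero n] {c : ZMod n → D}

theorem arcSum_full (i j : ZMod n) :
    G.arcSum ds dt p c i n = G.arcSum ds dt p c j n := by
  simp only [arcSum, lamSum, sum_map_arc]

variable [Finite D]

theorem total (H : G.Configuration w ds dt p c) (i : ZMod n) :
    G.arcSum ds dt p c i n = 1 ∨ G.arcSum ds dt p c i n = -1 := by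
  have := sum_lam_of_isSepCycle H.path.1 H.cycle.1
  simpa only [arcSum, lamSum, sum_map_arc] using this

/-- Both arcs are closed up by the same segment `P` of the shortest path, which has number 0 and is
no longer than either arc. The length bound for the two closed walks, together with the total ±1,
leaves only these possibilities. -/
theorem arc_dichotomy (H : G.Configuration w ds dt p c) {i : ZMod n} {k : ℕ} (hk : k ≤ n)
    (hi : G.Meets ds p c i) (hj : G.Meets ds p c (i + k)) :
    (G.arcSum ds dt p c i k = 0 ∨ G.arcSum ds dt p c i k = G.arcSum ds dt p c i n) ∧
    (G.arcSum ds dt p c i k = 0 →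
      G.IsMinWalk w (G.face (c i)) (arc c i k) (G.face (c (i + k)))) := by
  have hc := H.cycle.1.1.1
  have hn : (i + (k : ZMod n)) + ((n - k : ℕ) : ZMod n) = i := by
    rw [add_assoc, ← Nat.cast_add, Nat.add_sub_cancel' hk]; simp
  have hw1 := isWalk_arc hc i k
  have hw2 := isWalk_arc hc (i + k) (n - k)
  rw [hn] at hw2
  obtain ⟨P, hP, hP0⟩ := (H.path.isMinWalk H.pos).exists_onPath hi hj
  have hP0 := lamSum_eq_zero H.path.1 H.ne hP0
  have hlen : G.pathLength w (arc c i k) + G.pathLength w (arc c (i + k) (n - k))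
      = G.cycleLength w c := by
    rw [← pathLength_append, ← arc_add, Nat.add_sub_cancel' hk, pathLength, sum_map_arc,
      cycleLength]
  have hsum : G.arcSum ds dt p c i k + G.arcSum ds dt p c (i + k) (n - k)
      = G.arcSum ds dt p c i n := by
    rw [← arcSum_add, Nat.add_sub_cancel' hk]
  have hpos : 0 < G.cycleLength w c :=
    Finset.sum_pos (fun i _ => H.pos _) Finset.univ_nonempty
  have b1 := abs_lamSum_mul_le H.path.1 H.pos hpos.le H.cycle.2
    (isWalk_append.2 ⟨_, hw1, isWalk_reverse hP.1⟩)
  have b2 := abs_lamSum_mul_le H.path.1 H.pos hpos.le H.cycle.2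
    (isWalk_append.2 ⟨_, hw2, hP.1⟩)
  rw [lamSum_append, lamSum_reverse, hP0, neg_zero, add_zero, pathLength_append,
    pathLength_reverse] at b1
  rw [lamSum_append, hP0, add_zero, pathLength_append] at b2
  change |((G.arcSum ds dt p c i k : ℤ) : ℝ)| * _ ≤ _ at b1
  change |((G.arcSum ds dt p c (i + k) (n - k) : ℤ) : ℝ)| * _ ≤ _ at b2
  have d1 := hP.2 _ hw1
  have d2 := hP.2 _ (isWalk_reverse hw2)
  rw [pathLength_reverse] at d2
  have htot := H.total i
  -- Adding `b1` and `b2` gives at most the cycle length plus twice that of `P`, and `d1`, `d2`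
  -- bound the latter by the cycle length.
  have habs : |G.arcSum ds dt p c i k| + |G.arcSum ds dt p c (i + k) (n - k)| ≤ 2 := by
    have : ((|G.arcSum ds dt p c i k| + |G.arcSum ds dt p c (i + k) (n - k)| : ℤ) : ℝ)
        * G.cycleLength w c ≤ 2 * G.cycleLength w c := by
      push_cast
      linarith
    exact_mod_cast le_of_mul_le_mul_right this hpos
  refine ⟨?_, fun h0 => ⟨hw1, fun r hr => ?_⟩⟩
  · rcases abs_cases (G.arcSum ds dt p c i k) with h | h <;>
    rcases abs_cases (G.arcSum ds dt p c (i + k) (n - k)) with h' | h' <;>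
    omega
  · have h1 : |G.arcSum ds dt p c (i + k) (n - k)| = 1 := by
      rw [h0, zero_add] at hsum
      rw [hsum]
      rcases htot with h | h <;> simp [h]
    have h2 : |((G.arcSum ds dt p c (i + k) (n - k) : ℤ) : ℝ)| = 1 := by
      rw [← Int.cast_abs, h1, Int.cast_one]
    rw [h2] at b2
    have := hP.2 r hr
    linarith

/-- Two disjoint arcs between vertices of `p` cannot both have nonzero intersection number. -/
theorem not_both (H : G.Configuration w ds dt p c) {i : ZMod n} {k l m : ℕ}
    (h : k + l + m ≤ n)
    (h0 : G.Meets ds p c i) (h1 : G.Meets ds p c (i + k)) (h2 : G.Meets ds p c (i + (k + l : ℕ)))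
    (h3 : G.Meets ds p c (i + (k + l + m : ℕ))) (hk : G.arcSum ds dt p c i k ≠ 0) :
    G.arcSum ds dt p c (i + (k + l : ℕ)) m = 0 := by
  -- All five sums lie in {0, T} with T = ±1 the total. If the first arc has T, adding the second or
  -- the third cannot reach 2T, so these are 0.
  have a1 := (H.arc_dichotomy (by omega) h0 h1).1
  have a2 := (H.arc_dichotomy (by omega) h0 h2).1
  have a3 := (H.arc_dichotomy h h0 h3).1
  have a4 := (H.arc_dichotomy (i := i + k) (k := l) (by omega) h1
    (by rwa [add_assoc, ← Nat.cast_add])).1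
  have a5 := (H.arc_dichotomy (i := i + (k + l : ℕ)) (k := m) (by omega) h2
    (by rwa [add_assoc, ← Nat.cast_add])).1
  rw [arcSum_full _ i] at a4 a5
  have e1 := arcSum_add (G := G) (ds := ds) (dt := dt) (p := p) c i k l
  have e2 := arcSum_add (G := G) (ds := ds) (dt := dt) (p := p) c i (k + l) m
  have := H.total i
  omega

end Configuration

end PlaneGraph

/-! ### Gaps between marked indices, and consecutive crossings. -/

namespace PlaneGraph

variable {D : Type*} {G : PlaneGraph D} {ds dt : D} {p : List D} {w : G.Edge → ℝ}

theorem leftInd_of_leftOf {d : D} (h : G.LeftOf ds dt p d) : G.leftInd ds dt p d = 1 := if_pos h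

theorem leftInd_of_not_leftOf {d : D} (h : ¬ G.LeftOf ds dt p d) : G.leftInd ds dt p d = 0 :=
  if_neg h

/-- Two marked indices without marked indices between them. -/
structure IsGap {n : ℕ} (Q : ZMod n → Prop) (y x : ZMod n) : Prop where
  ne : y ≠ x
  left : Q y
  right : Q x
  between : ∀ u : ℕ, 0 < u → u < (x - y).val → ¬ Q (y + u)

section Gap

variable {n : ℕ} [NeZero n] {Q : ZMod n → Prop} {x y x' y' : ZMod n}

theorem val_sub_add_val_sub (h : x ≠ y) : (x - y).val + (y - x).val = n := by
  have h1 : y - x = -(x - y) := by ring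
  have : NeZero (x - y) := ⟨sub_ne_zero.2 h⟩
  have h2 := ZMod.val_lt (x - y)
  rw [h1, ZMod.val_neg_of_ne_zero]
  omega

theorem add_val_sub (x y : ZMod n) : y + ((x - y).val : ZMod n) = x := by
  rw [ZMod.natCast_zmod_val]; ring

theorem val_sub_pos (h : x ≠ y) : 0 < (x - y).val :=
  Nat.pos_of_ne_zero fun h0 => h (sub_eq_zero.1 ((ZMod.val_eq_zero _).1 h0))

theorem IsGap.le_of_marked (h : IsGap Q y x) {z : ZMod n} (hz : Q z) (hne : z ≠ y) :
    (x - y).val ≤ (z - y).val := by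
  by_contra hlt
  refine h.between _ (val_sub_pos hne) (not_le.1 hlt) ?_
  rwa [add_val_sub]

theorem IsGap.disjoint (h : IsGap Q y x) (h' : IsGap Q y' x') (hne : y' ≠ y) :
    (x - y).val ≤ (y' - y).val ∧ (y' - y).val + (x' - y').val ≤ n := by
  refine ⟨h.le_of_marked h'.left hne, ?_⟩
  have h1 := h'.le_of_marked h.left hne.symm
  have h2 := val_sub_add_val_sub hne
  omega

theorem IsGap.right_unique (h : IsGap Q y x) (h' : IsGap Q y x') : x = x' := by
  have h1 := h.le_of_marked h'.right h'.ne.symm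
  have h2 := h'.le_of_marked h.right h.ne.symm
  exact sub_left_injective (ZMod.val_injective n (le_antisymm h1 h2))

end Gap

namespace Configuration

variable {n : ℕ} [NeZero n] {c : ZMod n → D} [Finite D]

/-- Different gaps occupy disjoint arcs of the cycle, and `not_both` excludes two of them with
nonzero number. The marking `Q` is left general: it is used for the first vertices of crossings in
(B) and for all internal vertices in (A). -/
theorem gap_unique (H : G.Configuration w ds dt p c) {Q : ZMod n → Prop} {x y x' y' : ZMod n}
    (hQ : ∀ i, Q i → G.Meets ds p c i) (h : IsGap Q y x) (h' : IsGap Q y' x')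
    (h0 : G.arcSum ds dt p c y (x - y).val ≠ 0) (h0' : G.arcSum ds dt p c y' (x' - y').val ≠ 0) :
    y' = y ∧ x' = x := by
  by_cases hne : y' = y
  · subst hne
    exact ⟨rfl, h'.right_unique h⟩
  exfalso
  obtain ⟨h1, h2⟩ := h.disjoint h' hne
  have e1 : (x - y).val + ((y' - y).val - (x - y).val) = (y' - y).val := by omega
  have := H.not_both (i := y) (k := (x - y).val) (l := (y' - y).val - (x - y).val)
    (m := (x' - y').val) (by omega) (hQ _ h.left) (by rw [add_val_sub]; exact hQ _ h.right)
    (by rw [e1, add_val_sub]; exact hQ _ h'.left)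
    (by rw [e1, Nat.cast_add, ← add_assoc, add_val_sub, add_val_sub]; exact hQ _ h'.right) h0
  rw [e1, add_val_sub] at this
  exact h0' this

/-! ### Crossings -/

theorem face_step (H : G.Configuration w ds dt p c) (i : ZMod n) :
    G.face (G.rev (c i)) = G.face (c (i + 1)) := H.cycle.1.1.1 i

theorem leftInd_of_rightOf (H : G.Configuration w ds dt p c) {d : D}
    (h : G.RightOf ds dt p d) : G.leftInd ds dt p d = 0 :=
  leftInd_of_not_leftOf fun h' => h'.not_rightOf H.path.1 H.ne h

theorem not_onPath (H : G.Configuration w ds dt p c) {d : D}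
    (h : G.LeftOf ds dt p d ∨ G.RightOf ds dt p d) : ¬ G.OnPath p d :=
  fun h' => h.elim (h'.not_leftOf H.path.1 H.ne) (h'.not_rightOf H.path.1 H.ne)

theorem meets_of_side (H : G.Configuration w ds dt p c) {i : ZMod n}
    (h : G.LeftOf ds dt p (c i) ∨ G.RightOf ds dt p (c i)) : G.Meets ds p c i :=
  h.elim (fun h => h.mem_support H.path.1.1) (fun h => h.mem_support H.path.1.1)

theorem meets_of_side_rev (H : G.Configuration w ds dt p c) {i : ZMod n}
    (h : G.LeftOf ds dt p (G.rev (c i)) ∨ G.RightOf ds dt p (G.rev (c i))) :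
    G.Meets ds p c (i + 1) := by
  rw [Meets, ← H.face_step]
  exact h.elim (fun h => h.mem_support H.path.1.1) (fun h => h.mem_support H.path.1.1)

theorem entry_side {X : ZMod n × ℕ} (h : G.IsCrossing ds dt p c X) :
    G.LeftOf ds dt p (G.rev (c X.1)) ∨ G.RightOf ds dt p (G.rev (c X.1)) :=
  h.2.2.imp And.left And.left

theorem exit_side {X : ZMod n × ℕ} (h : G.IsCrossing ds dt p c X) :
    G.LeftOf ds dt p (c (X.1 + (X.2 : ZMod n))) ∨
      G.RightOf ds dt p (c (X.1 + (X.2 : ZMod n))) :=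
  (h.2.2.imp And.right And.right).symm

theorem leftInd_exit (H : G.Configuration w ds dt p c) {X : ZMod n × ℕ}
    (h : G.IsCrossing ds dt p c X) :
    G.leftInd ds dt p (c (X.1 + (X.2 : ZMod n))) = 1 - G.leftInd ds dt p (G.rev (c X.1)) := by
  rcases h.2.2 with ⟨h1, h2⟩ | ⟨h1, h2⟩
  · rw [leftInd_of_leftOf h1, H.leftInd_of_rightOf h2]; rfl
  · rw [leftInd_of_leftOf h2, H.leftInd_of_rightOf h1]; rfl

theorem not_onPath_entry (H : G.Configuration w ds dt p c) {X : ZMod n × ℕ}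
    (h : G.IsCrossing ds dt p c X) : ¬ G.OnPath p (c X.1) := fun h' =>
  H.not_onPath (entry_side h) (onPath_rev.2 h')

theorem crossing_le {X : ZMod n × ℕ}
    (h : G.IsCrossing ds dt p c X) {m : ℕ} (hm : 1 ≤ m) (hX : ¬ G.OnPath p (c (X.1 + m))) :
    X.2 ≤ m := by
  by_contra hlt
  exact hX (h.2.1 m hm (not_le.1 hlt))

/-- The exit edge is the first edge after the entry that is not on `p`, so the start of a crossing
determines its length. -/
theorem crossing_unique (H : G.Configuration w ds dt p c) {X Y : ZMod n × ℕ}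
    (hX : G.IsCrossing ds dt p c X) (hY : G.IsCrossing ds dt p c Y) (h : X.1 = Y.1) : X = Y := by
  refine Prod.ext h (le_antisymm ?_ ?_)
  · exact crossing_le hX hY.1 (by rw [h]; exact H.not_onPath (exit_side hY))
  · exact crossing_le hY hX.1 (by rw [← h]; exact H.not_onPath (exit_side hX))

theorem meets_of_crossing (H : G.Configuration w ds dt p c) {X : ZMod n × ℕ}
    (h : G.IsCrossing ds dt p c X) {u : ℕ} (hu : 1 ≤ u) (hu' : u ≤ X.2) :
    G.Meets ds p c (X.1 + u) := by
  rcases hu'.eq_or_lt with rfl | hu'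
  · exact H.meets_of_side (exit_side h)
  · exact OnPath.mem_support (dt := dt) H.path.1.1 (h.2.1 u hu hu')

theorem arcSum_succ (i : ZMod n) (k : ℕ) :
    G.arcSum ds dt p c i (k + 1) = G.arcSum ds dt p c i k + G.lam ds dt p (c (i + k)) := by
  rw [arcSum_add, arcSum_one]

/-- The state of an arc that leaves the path `p` at its beginning and has no crossings. -/
theorem crossing_free_state (H : G.Configuration w ds dt p c) {i : ZMod n}
    (h0 : G.LeftOf ds dt p (c i) ∨ G.RightOf ds dt p (c i)) (k : ℕ)
    (hno : ∀ t < k, ∀ r, ¬ G.IsCrossing ds dt p c (i + (t : ℕ), r)) :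
    (¬ G.Meets ds p c (i + k + 1) ∧
      G.arcSum ds dt p c i (k + 1) = G.leftInd ds dt p (c i)) ∨
    ∃ j ≤ k, (G.LeftOf ds dt p (G.rev (c (i + j))) ∨ G.RightOf ds dt p (G.rev (c (i + j)))) ∧
      (∀ u : ℕ, j < u → u ≤ k → G.OnPath p (c (i + u))) ∧
      G.arcSum ds dt p c i (k + 1)
        = G.leftInd ds dt p (c i) - G.leftInd ds dt p (G.rev (c (i + j))) := by
  -- One step along an edge off `p`. The invariant `arcSum + leftInd` at the current dart says that
  -- if the arc departs now to the left, the number already collected compensates for it.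
  have step : ∀ k : ℕ,
      G.arcSum ds dt p c i k + G.leftInd ds dt p (c (i + k)) = G.leftInd ds dt p (c i) →
      ¬ G.OnPath p (c (i + k)) →
      (¬ G.Meets ds p c (i + k + 1) ∧
        G.arcSum ds dt p c i (k + 1) = G.leftInd ds dt p (c i)) ∨
      ∃ j ≤ k, (G.LeftOf ds dt p (G.rev (c (i + j))) ∨ G.RightOf ds dt p (G.rev (c (i + j)))) ∧
        (∀ u : ℕ, j < u → u ≤ k → G.OnPath p (c (i + u))) ∧
        G.arcSum ds dt p c i (k + 1)
          = G.leftInd ds dt p (c i) - G.leftInd ds dt p (G.rev (c (i + j))) := by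
    intro k hk hP
    by_cases hM : G.Meets ds p c (i + k + 1)
    · right
      rw [Meets, ← H.face_step] at hM
      refine ⟨k, le_rfl, (sides H.path.1 hM).resolve_left (fun h => hP (onPath_rev.1 h)),
        fun u h1 h2 => absurd h1 (not_lt.2 h2), ?_⟩
      rw [arcSum_succ, lam]
      linarith
    · left
      refine ⟨hM, ?_⟩
      have : G.leftInd ds dt p (G.rev (c (i + k))) = 0 :=
        leftInd_of_not_leftOf fun h => hM (H.meets_of_side_rev (Or.inl h))
      rw [arcSum_succ, lam]
      linarith
  induction k with
  | zero =>
    refine step 0 (by simp [arcSum_zero]) ?_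
    simpa using H.not_onPath h0
  | succ k ih =>
    have e : i + ((k + 1 : ℕ) : ZMod n) = i + k + 1 := by push_cast; ring
    rcases ih fun t ht => hno t (by omega) with ⟨hM, hs⟩ | ⟨j, hj, hside, hrun, hs⟩
    · refine step (k + 1) ?_ ?_
      · rw [leftInd_of_not_leftOf, hs, add_zero]
        rw [e]
        exact fun h => hM (H.meets_of_side (Or.inl h))
      · rw [e]
        exact fun h => hM (OnPath.mem_support (dt := dt) H.path.1.1 h)
    · by_cases hP : G.OnPath p (c (i + (k + 1 : ℕ)))
      · right
        refine ⟨j, by omega, hside, fun u h1 h2 => ?_, ?_⟩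
        · rcases h2.eq_or_lt with rfl | h2
          · exact hP
          · exact hrun u h1 (by omega)
        · rw [arcSum_succ, hs, lam_of_onPath H.path.1 H.ne hP, add_zero]
      · refine step (k + 1) ?_ hP
        have hM : G.Meets ds p c (i + k + 1) := by
          rcases hj.eq_or_lt with rfl | hj
          · exact H.meets_of_side_rev hside
          · rw [Meets, ← H.face_step]
            exact OnPath.mem_support (dt := dt) H.path.1.1 (onPath_rev.2 (hrun k hj le_rfl))
        rw [← e] at hM
        have hside' := (sides H.path.1 hM).resolve_left hP
        -- Leaving `p` on the other side than the one entered at `j` would be a crossing starting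
        -- there, so the two sides agree and their contributions cancel.
        have hnc := hno j (by omega) (k + 1 - j)
        have e2 : i + (j : ZMod n) + ((k + 1 - j : ℕ) : ZMod n) = i + (k + 1 : ℕ) := by
          rw [add_assoc, ← Nat.cast_add, Nat.add_sub_cancel' (by omega)]
        have hnc' : ¬ ((G.LeftOf ds dt p (G.rev (c (i + j))) ∧
              G.RightOf ds dt p (c (i + (k + 1 : ℕ)))) ∨
            (G.RightOf ds dt p (G.rev (c (i + j))) ∧
              G.LeftOf ds dt p (c (i + (k + 1 : ℕ))))) := by
          intro hh
          refine hnc ⟨by simp only; omega, fun u h1 h2 => ?_, ?_⟩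
          · have := hrun (j + u) (by omega) (by simp only at h2; omega)
            rwa [Nat.cast_add, ← add_assoc] at this
          · simp only [e2]
            exact hh
        have heq : G.leftInd ds dt p (c (i + (k + 1 : ℕ)))
            = G.leftInd ds dt p (G.rev (c (i + j))) := by
          rcases hside with h1 | h1 <;> rcases hside' with h2 | h2
          · rw [leftInd_of_leftOf h1, leftInd_of_leftOf h2]
          · exact absurd (Or.inl ⟨h1, h2⟩) hnc'
          · exact absurd (Or.inr ⟨h1, h2⟩) hnc'
          · rw [H.leftInd_of_rightOf h1, H.leftInd_of_rightOf h2]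
        rw [heq, hs]
        ring

/-- The intersection number of an arc without crossings is determined by its ends. -/
theorem arcSum_crossing_free (H : G.Configuration w ds dt p c) {i : ZMod n}
    (h0 : G.LeftOf ds dt p (c i) ∨ G.RightOf ds dt p (c i)) {k : ℕ}
    (hno : ∀ t < k, ∀ r, ¬ G.IsCrossing ds dt p c (i + (t : ℕ), r))
    (hk : G.LeftOf ds dt p (G.rev (c (i + k))) ∨ G.RightOf ds dt p (G.rev (c (i + k)))) :
    G.arcSum ds dt p c i (k + 1)
      = G.leftInd ds dt p (c i) - G.leftInd ds dt p (G.rev (c (i + k))) := by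
  rcases H.crossing_free_state h0 k hno with ⟨hM, -⟩ | ⟨j, hj, -, hrun, hs⟩
  · exact absurd (H.meets_of_side_rev hk) hM
  · rcases hj.eq_or_lt with rfl | hj
    · exact hs
    · exact absurd (onPath_rev.2 (hrun k hj le_rfl)) (H.not_onPath hk)

theorem arcSum_of_crossing (H : G.Configuration w ds dt p c) {X : ZMod n × ℕ}
    (h : G.IsCrossing ds dt p c X) : G.arcSum ds dt p c (X.1 + 1) (X.2 - 1) = 0 := by
  refine lamSum_eq_zero H.path.1 H.ne fun d hd => ?_
  simp only [arc, List.mem_map, List.mem_range] at hd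
  obtain ⟨u, hu, rfl⟩ := hd
  have := h.2.1 (u + 1) (by omega) (by omega)
  rw [Nat.cast_add, Nat.cast_one, add_comm (u : ZMod n), ← add_assoc] at this
  exact this

/-- The intersection number of the arc between two consecutive crossings. -/
theorem arcSum_of_consecutive (H : G.Configuration w ds dt p c) {X Y : ZMod n × ℕ}
    (hX : G.IsCrossing ds dt p c X) (hY : G.IsCrossing ds dt p c Y) {m : ℕ} (hm : 1 ≤ m)
    (hXY : X.1 + m = Y.1)
    (hno : ∀ u : ℕ, 0 < u → u < m → ∀ r, ¬ G.IsCrossing ds dt p c (X.1 + u, r)) :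
    X.2 ≤ m ∧ G.arcSum ds dt p c (X.1 + 1) m
      = 1 - G.leftInd ds dt p (G.rev (c X.1)) - G.leftInd ds dt p (G.rev (c Y.1)) := by
  have hle : X.2 ≤ m := crossing_le hX hm (by rw [hXY]; exact H.not_onPath_entry hY)
  refine ⟨hle, ?_⟩
  have h1 := hX.1
  have e1 : X.1 + (X.2 : ZMod n) + ((m - X.2 : ℕ) : ZMod n) = Y.1 := by
    rw [add_assoc, ← Nat.cast_add, Nat.add_sub_cancel' hle, hXY]
  have h2 := H.arcSum_crossing_free (exit_side hX) (k := m - X.2) (fun t ht r => by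
      rw [add_assoc, ← Nat.cast_add]
      exact hno _ (by omega) (by omega) r) (by rw [e1]; exact entry_side hY)
  -- The run of `X` along `p` has `X.2 - 1` edges and contributes 0; the remaining edges, from the
  -- exit of `X` through the entry edge of `Y`, contain no start of a crossing after the exit and
  -- before `Y`.
  have e2 : m = (X.2 - 1) + (m - X.2 + 1) := by omega
  have e3 : X.1 + 1 + ((X.2 - 1 : ℕ) : ZMod n) = X.1 + (X.2 : ZMod n) := by
    rw [add_assoc, ← Nat.cast_one, ← Nat.cast_add, Nat.add_sub_cancel' h1]
  rw [e2, arcSum_add, H.arcSum_of_crossing hX, zero_add, e3, h2, e1, H.leftInd_exit hX]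

/-- The crossings `X` and `Y` have the same type. -/
def SameType (G : PlaneGraph D) (ds dt : D) (p : List D) (c : ZMod n → D) (X Y : ZMod n × ℕ) :
    Prop :=
  (G.IsDown ds dt p c X ∧ G.IsDown ds dt p c Y) ∨ (G.IsUp ds dt p c X ∧ G.IsUp ds dt p c Y)

/-- The right-hand side is the number collected from `X` to the next crossing `Y`: -1 for two down
crossings, 1 for two up crossings, 0 for mixed types. -/
theorem sameType_iff (H : G.Configuration w ds dt p c) {X Y : ZMod n × ℕ}
    (hX : G.IsCrossing ds dt p c X) (hY : G.IsCrossing ds dt p c Y) :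
    SameType G ds dt p c X Y ↔
      1 - G.leftInd ds dt p (G.rev (c X.1)) - G.leftInd ds dt p (G.rev (c Y.1)) ≠ 0 := by
  have key : ∀ {d : D}, G.leftInd ds dt p d = 1 → G.LeftOf ds dt p d := by
    intro d h
    by_contra h'
    rw [leftInd_of_not_leftOf h'] at h
    exact absurd h (by norm_num)
  constructor
  · rintro (⟨⟨-, h1⟩, ⟨-, h2⟩⟩ | ⟨⟨-, h1⟩, ⟨-, h2⟩⟩)
    · rw [leftInd_of_leftOf h1, leftInd_of_leftOf h2]; norm_num
    · rw [H.leftInd_of_rightOf h1, H.leftInd_of_rightOf h2]; norm_num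
  · intro h
    rcases entry_side hX with h1 | h1 <;> rcases entry_side hY with h2 | h2
    · exact Or.inl ⟨⟨hX, h1⟩, ⟨hY, h2⟩⟩
    · rw [leftInd_of_leftOf h1, H.leftInd_of_rightOf h2] at h; simp at h
    · rw [H.leftInd_of_rightOf h1, leftInd_of_leftOf h2] at h; simp at h
    · exact Or.inr ⟨⟨hX, h1⟩, ⟨hY, h2⟩⟩

/-- The index of the first internal vertex of a crossing. -/
def IsEntry (G : PlaneGraph D) (ds dt : D) (p : List D) (c : ZMod n → D) (i : ZMod n) : Prop :=
  ∃ r, G.IsCrossing ds dt p c (i - 1, r)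

theorem IsEntry.meets (H : G.Configuration w ds dt p c) {i : ZMod n}
    (h : IsEntry G ds dt p c i) : G.Meets ds p c i := by
  obtain ⟨r, hr⟩ := h
  have := H.meets_of_side_rev (entry_side hr)
  simpa using this

theorem consecutive_fst_ne (H : G.Configuration w ds dt p c) {X Y : ZMod n × ℕ}
    (h : G.Consecutive ds dt p c X Y) : Y.1 ≠ X.1 := fun he =>
  h.2.2.1 (H.crossing_unique h.1 h.2.1 he.symm)

theorem arcSum_consecutive (H : G.Configuration w ds dt p c) {X Y : ZMod n × ℕ}
    (h : G.Consecutive ds dt p c X Y) :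
    X.2 ≤ (Y.1 - X.1).val ∧ G.arcSum ds dt p c (X.1 + 1) (Y.1 - X.1).val
      = 1 - G.leftInd ds dt p (G.rev (c X.1)) - G.leftInd ds dt p (G.rev (c Y.1)) :=
  H.arcSum_of_consecutive h.1 h.2.1 (val_sub_pos (H.consecutive_fst_ne h)) (add_val_sub _ _)
    (fun u h1 h2 r => h.2.2.2 u r h1 h2)

theorem isGap_of_consecutive (H : G.Configuration w ds dt p c) {X Y : ZMod n × ℕ}
    (h : G.Consecutive ds dt p c X Y) :
    IsGap (IsEntry G ds dt p c) (X.1 + 1) (Y.1 + 1) where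
  ne h' := H.consecutive_fst_ne h (add_right_cancel h').symm
  left := ⟨X.2, by simpa using h.1⟩
  right := ⟨Y.2, by simpa using h.2.1⟩
  between u h1 h2 := by
    rintro ⟨r, hr⟩
    rw [add_sub_add_right_eq_sub] at h2
    refine h.2.2.2 u r h1 h2 ?_
    rwa [add_right_comm, add_sub_cancel_right] at hr

/-- The arcs from entry to entry are gaps with nonzero number, hence unique; a crossing is recovered
from its start. -/
theorem consecutive_sameType_unique (H : G.Configuration w ds dt p c) {X Y X' Y' : ZMod n × ℕ}
    (h : G.Consecutive ds dt p c X Y) (hs : SameType G ds dt p c X Y)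
    (h' : G.Consecutive ds dt p c X' Y') (hs' : SameType G ds dt p c X' Y') :
    X' = X ∧ Y' = Y := by
  have h0 := (H.sameType_iff h.1 h.2.1).1 hs
  rw [← (H.arcSum_consecutive h).2] at h0
  have h0' := (H.sameType_iff h'.1 h'.2.1).1 hs'
  rw [← (H.arcSum_consecutive h').2] at h0'
  obtain ⟨h1, h2⟩ := H.gap_unique (fun i hi => IsEntry.meets H hi) (H.isGap_of_consecutive h)
    (H.isGap_of_consecutive h') (by rwa [add_sub_add_right_eq_sub])
    (by rwa [add_sub_add_right_eq_sub])
  exact ⟨H.crossing_unique h'.1 h.1 (add_right_cancel h1),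
    H.crossing_unique h'.2.1 h.2.1 (add_right_cancel h2)⟩

/-- The numbers collected between successive crossings add up to ±1 over a full turn, so one of them
is nonzero. The first crossing `t` at which the accumulated number is nonzero and the last crossing
`k` before it form the pair. -/
theorem exists_consecutive_sameType (H : G.Configuration w ds dt p c)
    (hm : G.IsMultipleCrossing ds dt p c) :
    ∃ X Y, G.Consecutive ds dt p c X Y ∧ SameType G ds dt p c X Y := by
  classical
  obtain ⟨A, B, hAB, hA, hB⟩ := hm
  have hn : 0 < n := Nat.pos_of_ne_zero (NeZero.ne n)
  have h1 : ∃ t : ℕ, 1 ≤ t ∧ (∃ r, G.IsCrossing ds dt p c (A.1 + t, r)) ∧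
      G.arcSum ds dt p c (A.1 + 1) t ≠ 0 := by
    refine ⟨n, hn, ⟨A.2, by simpa using hA⟩, fun h => ?_⟩
    rcases H.total (A.1 + 1) with h' | h' <;> rw [h] at h' <;> norm_num at h'
  let t := Nat.find h1
  obtain ⟨ht1, ⟨r, hr⟩, ht0⟩ : 1 ≤ t ∧ (∃ r, G.IsCrossing ds dt p c (A.1 + t, r)) ∧
      G.arcSum ds dt p c (A.1 + 1) t ≠ 0 := Nat.find_spec h1
  have htn : t ≤ n := by
    refine Nat.find_min' h1 ⟨hn, ⟨A.2, by simpa using hA⟩, fun h => ?_⟩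
    rcases H.total (A.1 + 1) with h' | h' <;> rw [h] at h' <;> norm_num at h'
  let P : ℕ → Prop := fun k => ∃ r, G.IsCrossing ds dt p c (A.1 + k, r)
  have hP0 : P 0 := ⟨A.2, by simpa using hA⟩
  let k := Nat.findGreatest P (t - 1)
  have hkt : k ≤ t - 1 := Nat.findGreatest_le _
  obtain ⟨q, hq⟩ : P k := Nat.findGreatest_spec (Nat.zero_le _) hP0
  have hno : ∀ u, k < u → u < t → ¬ P u := fun u h1 h2 =>
    Nat.findGreatest_is_greatest h1 (by omega)
  have hk0 : G.arcSum ds dt p c (A.1 + 1) k = 0 := by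
    rcases Nat.eq_zero_or_pos k with h | h
    · rw [h, arcSum_zero]
    · by_contra h'
      exact Nat.find_min h1 (show k < t by omega) ⟨h, ⟨q, hq⟩, h'⟩
  -- If `t - k` were a full turn, `A` would be the only crossing. The strict bound also keeps `t -
  -- k` a representative modulo `n`.
  have hlt : t - k < n := by
    by_contra hge
    have hk : k = 0 := by omega
    have ht : t = n := by omega
    have all : ∀ Z, G.IsCrossing ds dt p c Z → Z.1 = A.1 := by
      intro Z hZ
      by_contra hne
      refine hno (Z.1 - A.1).val (by rw [hk]; exact val_sub_pos hne)
        (by rw [ht]; exact ZMod.val_lt _) ⟨Z.2, ?_⟩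
      rw [add_val_sub]
      exact hZ
    exact hAB (H.crossing_unique hA hB (all B hB).symm)
  have e1 : A.1 + (k : ZMod n) + ((t - k : ℕ) : ZMod n) = A.1 + t := by
    rw [add_assoc, ← Nat.cast_add, Nat.add_sub_cancel' (by omega)]
  have e2 : (A.1 + (t : ZMod n) - (A.1 + k)).val = t - k := by
    rw [← e1, add_sub_cancel_left, ZMod.val_natCast_of_lt hlt]
  have hcons : G.Consecutive ds dt p c (A.1 + k, q) (A.1 + t, r) := by
    refine ⟨hq, hr, fun he => ?_, fun u r' h1 h2 h3 => ?_⟩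
    · have := congrArg Prod.fst he
      simp only at this
      rw [this, sub_self, ZMod.val_zero] at e2
      omega
    · simp only at h2 h3
      rw [e2] at h2
      refine hno (k + u) (by omega) (by omega) ⟨r', ?_⟩
      rwa [Nat.cast_add, ← add_assoc]
  refine ⟨_, _, hcons, (H.sameType_iff hq hr).2 ?_⟩
  have h2 := (H.arcSum_consecutive hcons).2
  simp only at h2
  rw [← h2, e2]
  have h3 : t = k + (t - k) := by omega
  rw [h3, arcSum_add, hk0, zero_add, add_right_comm] at ht0
  exact ht0

end Configuration

end PlaneGraph

/-! ### Order along the path; existence and uniqueness of the decomposition. -/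

namespace PlaneGraph

variable {D : Type*} {G : PlaneGraph D} {ds dt : D} {p : List D} {w : G.Edge → ℝ}

/-- A shortest walk between two vertices of a shortest walk `p` runs along `p` isometrically. -/
theorem IsMinWalk.exists_isometry {f g u v : G.Face} {q : List D} (hw : ∀ e, 0 < w e)
    (hp : G.IsMinWalk w f p g) (hq : G.IsMinWalk w u q v) (hu : u ∈ G.support f p)
    (hv : v ∈ G.support f p) :
    ∃ A ε : ℝ, (ε = 1 ∨ ε = -1) ∧ ∀ (h : G.Face) (i k : ℕ), (G.support u q)[i]? = some h →
      (G.support f p)[k]? = some h →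
      G.pathLength w (p.take k) = A + ε * G.pathLength w (q.take i) := by
  obtain ⟨a, ha⟩ := List.mem_iff_getElem?.1 hu
  obtain ⟨b, hb⟩ := List.mem_iff_getElem?.1 hv
  have hu0 : (G.support u q)[0]? = some u := rfl
  have hv0 := getElem?_support_length hq.1
  have hD := hq.abs_sub_eq hp hu0 hv0 ha hb hw
  have h0 : G.pathLength w (q.take 0) = 0 := by simp [pathLength]
  have hlen := pathLength_nonneg hw q
  rw [h0, List.take_length, zero_sub, abs_neg, abs_of_nonneg hlen] at hD
  have bound : ∀ i, 0 ≤ G.pathLength w (q.take i) ∧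
      G.pathLength w (q.take i) ≤ G.pathLength w q := by
    intro i
    refine ⟨pathLength_nonneg hw _, ?_⟩
    conv_rhs => rw [← List.take_append_drop i q, pathLength_append]
    have := pathLength_nonneg hw (q.drop i)
    linarith
  -- A vertex of `q` lies between `u` and `v` metrically. Its distances to both, measured along `p`
  -- as well, leave a single possible position on `p`.
  have main : ∀ (h : G.Face) (i k : ℕ), (G.support u q)[i]? = some h →
      (G.support f p)[k]? = some h →
      G.pathLength w (q.take i) = |G.pathLength w (p.take k) - G.pathLength w (p.take a)| ∧
      G.pathLength w q - G.pathLength w (q.take i)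
        = |G.pathLength w (p.take k) - G.pathLength w (p.take b)| := by
    intro h i k hi hk
    have h1 := hq.abs_sub_eq hp hi hu0 hk ha hw
    have h2 := hq.abs_sub_eq hp hi hv0 hk hb hw
    obtain ⟨b1, b2⟩ := bound i
    rw [h0, sub_zero, abs_of_nonneg b1] at h1
    rw [List.take_length, abs_sub_comm, abs_of_nonneg (by linarith)] at h2
    exact ⟨h1, h2⟩
  rcases le_total (G.pathLength w (p.take a)) (G.pathLength w (p.take b)) with hab | hab
  · refine ⟨G.pathLength w (p.take a), 1, Or.inl rfl, fun h i k hi hk => ?_⟩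
    rw [abs_sub_comm, abs_of_nonneg (by linarith)] at hD
    obtain ⟨h1, h2⟩ := main h i k hi hk
    have := bound i
    rcases abs_cases (G.pathLength w (p.take k) - G.pathLength w (p.take a)) with h3 | h3 <;>
    rcases abs_cases (G.pathLength w (p.take k) - G.pathLength w (p.take b)) with h4 | h4 <;>
    linarith
  · refine ⟨G.pathLength w (p.take a), -1, Or.inr rfl, fun h i k hi hk => ?_⟩
    rw [abs_of_nonneg (by linarith)] at hD
    obtain ⟨h1, h2⟩ := main h i k hi hk
    have := bound i
    rcases abs_cases (G.pathLength w (p.take k) - G.pathLength w (p.take a)) with h3 | h3 <;>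
    rcases abs_cases (G.pathLength w (p.take k) - G.pathLength w (p.take b)) with h4 | h4 <;>
    linarith

namespace Configuration

variable {n : ℕ} [NeZero n] {c : ZMod n → D} [Finite D]

/-- The index of an internal vertex of a crossing. -/
def IsInternal (G : PlaneGraph D) (ds dt : D) (p : List D) (c : ZMod n → D) (i : ZMod n) : Prop :=
  ∃ X : ZMod n × ℕ, G.IsCrossing ds dt p c X ∧ ∃ u : ℕ, 1 ≤ u ∧ u ≤ X.2 ∧ X.1 + (u : ZMod n) = i

theorem IsInternal.meets (H : G.Configuration w ds dt p c) {i : ZMod n}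
    (h : IsInternal G ds dt p c i) : G.Meets ds p c i := by
  obtain ⟨X, hX, u, h1, h2, rfl⟩ := h
  exact H.meets_of_crossing hX h1 h2

theorem mem_crossingVertices_iff {f : G.Face} :
    f ∈ G.crossingVertices ds dt p c ↔ ∃ i, IsInternal G ds dt p c i ∧ G.face (c i) = f := by
  constructor
  · rintro ⟨X, hX, u, h1, h2, rfl⟩
    exact ⟨_, ⟨X, hX, u, h1, h2, rfl⟩, rfl⟩
  · rintro ⟨_, ⟨X, hX, u, h1, h2, rfl⟩, rfl⟩
    exact ⟨X, hX, u, h1, h2, rfl⟩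

theorem face_mem_crossingVertices_iff (H : G.Configuration w ds dt p c) {i : ZMod n} :
    G.face (c i) ∈ G.crossingVertices ds dt p c ↔ IsInternal G ds dt p c i := by
  rw [mem_crossingVertices_iff]
  constructor
  · rintro ⟨j, hj, h⟩
    rwa [← H.cycle.1.1.2.1 h]
  · exact fun h => ⟨i, h, rfl⟩

theorem isMinWalk_arc (H : G.Configuration w ds dt p c) {x y : ZMod n}
    (hx : G.Meets ds p c x) (hy : G.Meets ds p c y)
    (h0 : G.arcSum ds dt p c x (y - x).val = 0) :
    G.IsMinWalk w (G.face (c x)) (arc c x (y - x).val) (G.face (c y)) := by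
  have := (H.arc_dichotomy (ZMod.val_lt (y - x)).le hx (by rwa [add_val_sub])).2 h0
  rwa [add_val_sub] at this

/-- Of two complementary arcs, a nonzero one already carries the whole total. -/
theorem arcSum_complement (H : G.Configuration w ds dt p c) {x y : ZMod n} (hne : y ≠ x)
    (hx : G.Meets ds p c x) (hy : G.Meets ds p c y)
    (h0 : G.arcSum ds dt p c y (x - y).val ≠ 0) : G.arcSum ds dt p c x (y - x).val = 0 := by
  have h1 := arcSum_add (G := G) (ds := ds) (dt := dt) (p := p) c y (x - y).val (y - x).val
  rw [val_sub_add_val_sub hne.symm, add_val_sub] at h1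
  have h2 := (H.arc_dichotomy (ZMod.val_lt (x - y)).le hy (by rwa [add_val_sub])).1
  omega

theorem IsGap.val_le {Q : ZMod n → Prop} {x y i : ZMod n} (h : IsGap Q y x) (hi : Q i) :
    (i - x).val ≤ (y - x).val := by
  by_contra hlt
  have h1 := val_sub_add_val_sub h.ne
  have h2 := ZMod.val_lt (i - x)
  refine h.between ((i - x).val - (y - x).val) (by omega) (by omega) ?_
  have : y + (((i - x).val - (y - x).val : ℕ) : ZMod n) = i := by
    rw [Nat.cast_sub (by omega), ZMod.natCast_zmod_val, ZMod.natCast_zmod_val]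
    ring
  rwa [this]

/-- A gap between internal vertices with nonzero intersection number gives a decomposition. -/
theorem isDecomposition_of_isGap (H : G.Configuration w ds dt p c) {x y : ZMod n}
    (h : IsGap (IsInternal G ds dt p c) y x) (h0 : G.arcSum ds dt p c y (x - y).val ≠ 0) :
    G.IsDecomposition w ds dt p c x y := by
  have hx := h.right.meets H
  have hy := h.left.meets H
  have hmin := H.isMinWalk_arc hx hy (H.arcSum_complement h.ne hx hy h0)
  have hpmin := H.path.isMinWalk H.pos
  have hpath := isPath_arc H.cycle.1.1 x (ZMod.val_lt (y - x))
  rw [add_val_sub] at hpath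
  have hpos : ∀ i, IsInternal G ds dt p c i → (i - x).val ≤ (y - x).val ∧
      (G.support (G.face (c x)) (arc c x (y - x).val))[(i - x).val]? = some (G.face (c i)) := by
    intro i hi
    have h1 := IsGap.val_le h hi
    refine ⟨h1, ?_⟩
    have := getElem?_support_arc H.cycle.1.1.1 x h1
    rwa [add_val_sub] at this
  have hle : ∀ {f : G.Face} {k : ℕ}, (G.support (G.face ds) p)[k]? = some f → k ≤ p.length :=
    fun hk => (isWalk_of_getElem?_support hpmin.1 hk).1
  have hle' : ∀ {f : G.Face} {k : ℕ},
      (G.support (G.face (c x)) (arc c x (y - x).val))[k]? = some f →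
      k ≤ (arc c x (y - x).val).length :=
    fun hk => (isWalk_of_getElem?_support hmin.1 hk).1
  -- The isometry settles both remaining geometric claims: `ε` decides between the order of `p` and
  -- its reverse, and positions between the two ends of the arc correspond to positions between `a`
  -- and `b` on `p`.
  obtain ⟨A, ε, hε, hA⟩ := hpmin.exists_isometry H.pos hmin hx hy
  refine ⟨h.ne.symm, H.face_mem_crossingVertices_iff.2 h.right,
    H.face_mem_crossingVertices_iff.2 h.left,
    fun u h1 h2 h3 => h.between u h1 h2 (H.face_mem_crossingVertices_iff.1 h3),
    ⟨hpath, fun q hq => hmin.2 q hq.1⟩, ?_, ?_, ?_⟩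
  · intro f hf
    obtain ⟨i, hi, rfl⟩ := mem_crossingVertices_iff.1 hf
    exact List.mem_iff_getElem?.2 ⟨_, (hpos i hi).2⟩
  · refine hε.imp (fun hε => ?_) (fun hε => ?_)
    all_goals
      intro f _ g _ i j k l hi hj hk hl
      have e1 := hA f i k hi hk
      have e2 := hA g j l hj hl
      rw [lt_iff_pathLength_take_lt H.pos (hle' hi) (hle' hj),
        lt_iff_pathLength_take_lt H.pos (by first | exact hle hk | exact hle hl)
          (by first | exact hle hl | exact hle hk), e1, e2, hε]
      constructor <;> intro <;> linarith
  · intro f hf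
    obtain ⟨i, hi, rfl⟩ := mem_crossingVertices_iff.1 hf
    obtain ⟨a, ha⟩ := List.mem_iff_getElem?.1 hx
    obtain ⟨b, hb⟩ := List.mem_iff_getElem?.1 hy
    obtain ⟨k, hk⟩ := List.mem_iff_getElem?.1 (hi.meets H)
    refine ⟨a, k, b, ha, hk, hb, ?_⟩
    have e1 := hA _ 0 a rfl ha
    have e2 := hA _ _ k (hpos i hi).2 hk
    have e3 := hA _ _ b (getElem?_support_length hmin.1) hb
    have b1 : G.pathLength w (List.take 0 (arc c x (y - x).val)) = 0 := by simp [pathLength]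
    have b2 := pathLength_nonneg H.pos (List.take (i - x).val (arc c x (y - x).val))
    have b3 : G.pathLength w (List.take (i - x).val (arc c x (y - x).val))
        ≤ G.pathLength w (List.take (arc c x (y - x).val).length (arc c x (y - x).val)) := by
      rw [List.take_length]
      conv_rhs => rw [← List.take_append_drop (i - x).val (arc c x (y - x).val),
        pathLength_append]
      have := pathLength_nonneg H.pos ((arc c x (y - x).val).drop (i - x).val)
      linarith
    rw [b1] at e1
    refine hε.imp (fun hε => ?_) (fun hε => ?_) <;> rw [hε] at e1 e2 e3
    all_goals
      constructor
      all_goals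
        by_contra hlt
        rw [not_le, lt_iff_pathLength_take_lt H.pos
          (by first | exact hle hk | exact hle ha | exact hle hb)
          (by first | exact hle hk | exact hle ha | exact hle hb)] at hlt
        linarith

/-- The gap runs from the last internal vertex of `X`, at `X.1 + X.2`, to the first one of `Y`, at
`Y.1 + 1`. -/
theorem val_gap (H : G.Configuration w ds dt p c) {X Y : ZMod n × ℕ}
    (h : G.Consecutive ds dt p c X Y) :
    (Y.1 + 1 - (X.1 + (X.2 : ZMod n))).val = (Y.1 - X.1).val + 1 - X.2 := by
  have h1 := (H.arcSum_consecutive h).1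
  have h2 := h.1.1
  have h3 := ZMod.val_lt (Y.1 - X.1)
  have : Y.1 + 1 - (X.1 + (X.2 : ZMod n)) = (((Y.1 - X.1).val + 1 - X.2 : ℕ) : ZMod n) := by
    rw [Nat.cast_sub (by omega), Nat.cast_add, ZMod.natCast_zmod_val]
    push_cast
    ring
  rw [this, ZMod.val_natCast_of_lt (by omega)]

/-- There are no internal vertices of crossings strictly between two consecutive crossings. -/
theorem isGap_internal (H : G.Configuration w ds dt p c) {X Y : ZMod n × ℕ}
    (h : G.Consecutive ds dt p c X Y) :
    IsGap (IsInternal G ds dt p c) (X.1 + (X.2 : ZMod n)) (Y.1 + 1) where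
  ne he := by
    have h1 := H.val_gap h
    have h2 := (H.arcSum_consecutive h).1
    rw [he, sub_self, ZMod.val_zero] at h1
    omega
  left := ⟨X, h.1, X.2, h.1.1, le_rfl, rfl⟩
  right := ⟨Y, h.2.1, 1, le_rfl, h.2.1.1, by simp⟩
  between v h1 h2 := by
    rintro ⟨Z, hZ, u, hu1, hu2, he⟩
    rw [H.val_gap h] at h2
    -- Either `Z` starts before the last vertex of `X`, and then the exit edge of `X` would be one
    -- of its edges along `p`; or `Z` starts strictly between `X` and `Y`, against consecutiveness.
    rcases lt_or_ge v u with hvu | hvu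
    · have h3 := hZ.2.1 (u - v) (by omega) (by omega)
      have h4 : Z.1 + ((u - v : ℕ) : ZMod n) = X.1 + (X.2 : ZMod n) := by
        rw [Nat.cast_sub hvu.le, ← add_sub_assoc, he, add_sub_cancel_right]
      rw [h4] at h3
      exact H.not_onPath (exit_side h.1) h3
    · have h3 := h.1.1
      have h4 : X.1 + ((X.2 + v - u : ℕ) : ZMod n) = Z.1 := by
        rw [Nat.cast_sub (by omega), Nat.cast_add, ← add_sub_assoc, ← add_assoc, ← he,
          add_sub_cancel_right]
      refine h.2.2.2 (X.2 + v - u) Z.2 (by omega) (by omega) ?_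
      rw [h4]
      exact hZ

theorem arcSum_gap (H : G.Configuration w ds dt p c) {X Y : ZMod n × ℕ}
    (h : G.Consecutive ds dt p c X Y) (hs : SameType G ds dt p c X Y) :
    G.arcSum ds dt p c (X.1 + (X.2 : ZMod n)) (Y.1 + 1 - (X.1 + (X.2 : ZMod n))).val ≠ 0 := by
  have h0 := (H.sameType_iff h.1 h.2.1).1 hs
  obtain ⟨h1, h2⟩ := H.arcSum_consecutive h
  rw [← h2] at h0
  have h3 := h.1.1
  have e1 : (Y.1 - X.1).val = (X.2 - 1) + ((Y.1 - X.1).val + 1 - X.2) := by omega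
  have e2 : X.1 + 1 + ((X.2 - 1 : ℕ) : ZMod n) = X.1 + (X.2 : ZMod n) := by
    rw [add_assoc, ← Nat.cast_one, ← Nat.cast_add, Nat.add_sub_cancel' h3]
  rw [e1, arcSum_add, H.arcSum_of_crossing h.1, zero_add, e2] at h0
  rwa [H.val_gap h]

theorem pathLength_arc_eq_zero (H : G.Configuration w ds dt p c) {i : ZMod n} {k : ℕ}
    (h : G.pathLength w (arc c i k) ≤ 0) : k = 0 := by
  by_contra hk
  refine absurd (pathLength_pos H.pos (a := arc c i k) fun h' => hk ?_) (not_lt.2 h)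
  rw [← length_arc c i k, h', List.length_nil]

/-- If the two arcs of a gap are both shortest, then a gap with nonzero intersection number is
its complement. -/
theorem eq_complement (H : G.Configuration w ds dt p c) {Q : ZMod n → Prop} {x y x' y' : ZMod n}
    (hQ : ∀ i, Q i → G.Meets ds p c i) (h : IsGap Q y x) (h' : IsGap Q y' x')
    (h0 : G.arcSum ds dt p c y (x - y).val ≠ 0) (h0' : G.arcSum ds dt p c y' (x' - y').val = 0)
    (hmin : G.IsMinWalk w (G.face (c x')) (arc c x' (y' - x').val) (G.face (c y'))) :
    y' = x ∧ x' = y := by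
  have hne : y' ≠ y := by
    rintro rfl
    obtain rfl := h.right_unique h'
    exact h0 h0'
  obtain ⟨h1, h2⟩ := h.disjoint h' hne
  have hmin' := H.isMinWalk_arc (hQ _ h'.left) (hQ _ h'.right) h0'
  have hminxy := H.isMinWalk_arc (hQ _ h.right) (hQ _ h.left)
    (H.arcSum_complement h.ne (hQ _ h.right) (hQ _ h.left) h0)
  -- Both arcs of the second gap are shortest, hence of half the cycle length. The second gap lies
  -- inside the shortest arc from `x` to `y`, itself at most half the cycle, so the leftovers `a`
  -- and `b` have length 0 and are empty.
  have l1 := hmin.length_eq hmin'.reverse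
  rw [pathLength_reverse] at l1
  have l2 := hminxy.2 _ (isWalk_reverse (by
    simpa only [add_val_sub] using isWalk_arc H.cycle.1.1.1 y (x - y).val))
  rw [pathLength_reverse] at l2
  have full : ∀ i j : ZMod n, i ≠ j → G.pathLength w (arc c i (j - i).val)
      + G.pathLength w (arc c j (i - j).val) = G.cycleLength w c := by
    intro i j hij
    have e := arc_add c i (j - i).val (i - j).val
    rw [add_val_sub, val_sub_add_val_sub hij.symm] at e
    rw [← pathLength_append, ← e, pathLength, sum_map_arc, cycleLength]
  have f1 := full _ _ h.ne
  have f2 := full _ _ h'.ne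
  have hs := val_sub_add_val_sub h.ne
  obtain ⟨a, ha⟩ := Nat.exists_eq_add_of_le h1
  obtain ⟨b, hb⟩ := Nat.exists_eq_add_of_le h2
  have e1 : (y - x).val = a + (x' - y').val + b := by omega
  have e2 : x + (a : ZMod n) = y' := by
    have := add_val_sub y' y
    rwa [ha, Nat.cast_add, ← add_assoc, add_val_sub] at this
  have e3 : x + ((a + (x' - y').val : ℕ) : ZMod n) = x' := by
    rw [Nat.cast_add, ← add_assoc, e2, add_val_sub]
  have l3 : G.pathLength w (arc c x (y - x).val) = G.pathLength w (arc c x a)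
      + G.pathLength w (arc c y' (x' - y').val) + G.pathLength w (arc c x' b) := by
    rw [e1, arc_add, arc_add, pathLength_append, pathLength_append, e2, e3]
  have n1 := pathLength_nonneg H.pos (arc c x a)
  have n2 := pathLength_nonneg H.pos (arc c x' b)
  have ha0 : a = 0 := H.pathLength_arc_eq_zero (i := x) (by linarith)
  have hb0 : b = 0 := H.pathLength_arc_eq_zero (i := x') (by linarith)
  refine ⟨by rw [← e2, ha0]; simp, ?_⟩
  rw [← e3, ← add_val_sub y x, e1, hb0, add_zero]

theorem existsUnique_decomposition (H : G.Configuration w ds dt p c) {X Y : ZMod n × ℕ}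
    (h : G.Consecutive ds dt p c X Y) (hs : SameType G ds dt p c X Y) :
    ∃! xy : ZMod n × ZMod n, G.IsDecomposition w ds dt p c xy.1 xy.2 := by
  have hgap := H.isGap_internal h
  have h0 := H.arcSum_gap h hs
  refine ⟨(Y.1 + 1, X.1 + (X.2 : ZMod n)), H.isDecomposition_of_isGap hgap h0, ?_⟩
  rintro ⟨x', y'⟩ hd
  simp only at hd
  have hgap' : IsGap (IsInternal G ds dt p c) y' x' :=
    ⟨hd.ne.symm, H.face_mem_crossingVertices_iff.1 hd.right_mem,
      H.face_mem_crossingVertices_iff.1 hd.left_mem,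
      fun u h1 h2 h3 => hd.no_crossing u h1 h2 (H.face_mem_crossingVertices_iff.2 h3)⟩
  have hQ : ∀ i, IsInternal G ds dt p c i → G.Meets ds p c i := fun i hi => hi.meets H
  by_cases h0' : G.arcSum ds dt p c y' (x' - y').val = 0
  · exfalso
    obtain ⟨rfl, rfl⟩ := H.eq_complement hQ hgap hgap' h0 h0' (hd.shortest.isMinWalk H.pos)
    have h1 := H.consecutive_fst_ne h
    have hYX : G.Consecutive ds dt p c Y X := by
      refine ⟨h.2.1, h.1, h.2.2.1.symm, fun u r hu1 hu2 hr => ?_⟩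
      -- A crossing starting at `Y.1 + u` has its first internal vertex at `Y.1 + 1 + u`, which
      -- still lies inside the gap since that ends at the last internal vertex of `X`.
      refine hgap'.between u hu1 ?_ ⟨_, hr, 1, le_rfl, hr.1, by push_cast; ring⟩
      have h2 := val_sub_add_val_sub h1
      have h3 := val_sub_add_val_sub hgap.ne
      have h4 := H.val_gap h
      have h5 := h.1.1
      omega
    have hs' : SameType G ds dt p c Y X := hs.imp And.symm And.symm
    exact h.2.2.1 (H.consecutive_sameType_unique h hs hYX hs').2
  · obtain ⟨rfl, rfl⟩ := H.gap_unique hQ hgap hgap' h0 h0'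
    rfl

end Configuration

end PlaneGraph

/-- `G` is a connected plane graph with positive capacities `w`, which are the lengths of the dual
edges; `ds` and `dt` are corners of the faces `fs` and `ft` at `s` and `t`; `p` is a shortest path
of the dual graph from `fs` to `ft`, extended through these corners by dummy edges; and `c` is a
multiple-crossing shortest `st`-separating cycle of the dual graph. -/
theorem mainTheorem5 {D : Type*} [Finite D] (G : PlaneGraph D)
    (w : G.Edge → ℝ) (hw : ∀ e, 0 < w e)
    (s t : G.Vertex) (hst : s ≠ t) (fs ft : G.Face)
    (ds dt : D) (hds : G.vertex ds = s ∧ G.face ds = fs) (hdt : G.vertex dt = t ∧ G.face dt = ft)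
    (p : List D) (hp : G.IsShortestPath w fs p ft)
    (n : ℕ) [NeZero n] (c : ZMod n → D) (hc : G.IsShortestSepCycle w s t c)
    (hmult : G.IsMultipleCrossing ds dt p c) :
    (∃! xy : ZMod n × ZMod n, G.IsDecomposition w ds dt p c xy.1 xy.2) ∧
    (∃! XY : (ZMod n × ℕ) × (ZMod n × ℕ), G.Consecutive ds dt p c XY.1 XY.2 ∧
      ((G.IsDown ds dt p c XY.1 ∧ G.IsDown ds dt p c XY.2) ∨
       (G.IsUp ds dt p c XY.1 ∧ G.IsUp ds dt p c XY.2))) := by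
  obtain ⟨rfl, rfl⟩ := hds
  obtain ⟨rfl, rfl⟩ := hdt
  have H : G.Configuration w ds dt p c := ⟨hw, fun h => hst (by rw [h]), hp, hc⟩
  obtain ⟨X, Y, h, hs⟩ := H.exists_consecutive_sameType hmult
  refine ⟨H.existsUnique_decomposition h hs, (X, Y), ⟨h, hs⟩, ?_⟩
  rintro ⟨X', Y'⟩ ⟨h', hs'⟩
  obtain ⟨h1, h2⟩ := H.consecutive_sameType_unique h hs h' hs'
  exact Prod.ext h1 h2
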